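/- Let $G$ be a word-hyperbolic group, i.e. a group with a finite generating set $T$ such that the word metric $\rho=\rho_T$ satisfies, for some $\delta\ge 0$ and all $x,y,z,w\in G$, $$\rho(x,y)+\rho(z,w)\le\max\{\rho(x,z)+\rho(y,w),\ \rho(x,w)+\rho(y,z)\}+\delta .$$ Let $S$ be any finite generating set of $G$ and let $\ell$ be its word-length function: $\ell(g)$ is the least length of a word in the elements of $S$ and their inverses that represents $g$. Let $A=C_c(G)$ be the $*$-algebra of finitely supported complex functions on $G$, acting on $\ell^2(G)$ by left convolution, so that its norm closure is the reduced group $C^*$-algebra $C^*_r(G)$. Let $D=M_\ell$ be the operator of pointwise multiplication by $\ell$ on $\ell^2(G)$, with domain $\{\xi\in\ell^2(G):\ell\,\xi\in\ell^2(G)\}$, and for $f\in A$ put $L(f)=\|[D,f]\|$. Let $S(C^*_r(G))$ be the state space of $C^*_r(G)$ and put, for states $\mu,\nu$, $$\rho_L(\mu,\nu)=\sup\{|\mu(f)-\nu(f)|:\ f\in A,\ L(f)\le 1\}.$$ Then, for every $f\in A$, the operator $[D,f]$ is densely defined and bounded; $L$ is a seminorm on $A$ with $L(f)=0$ if and only if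 $f\in\mathbb C1_A$; and $\rho_L$ is a finite-valued metric on $S(C^*_r(G))$ whose topology coincides with the weak-$*$ topology. That is, $L$ is a Lip-norm, and $C^*_r(G)$ (through its dense $*$-subalgebra $A$) with $L$ is a compact quantum metric space. -/

import Mathlib

open scoped ENNReal Topology ComplexOrder

noncomputable section

/-! ## Word lengths and word-hyperbolic groups -/

/-- The word length of `g` with respect to `S`: the least length of a word in the letters
`s` and `s⁻¹`, `s ∈ S`, that represents `g`. (Only used when `S` generates the group.) -/
def wordLength {G : Type*} [Group G] (S : Set G) (g : G) : ℕ :=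
  sInf {n : ℕ | ∃ w : List G, w.length = n ∧ (∀ s ∈ w, s ∈ S ∨ s⁻¹ ∈ S) ∧ w.prod = g}

/-- The left-invariant word metric `ρ(x, y) = ℓ(x⁻¹ y)`. -/
def wordDist {G : Type*} [Group G] (S : Set G) (x y : G) : ℝ :=
  (wordLength S (x⁻¹ * y) : ℝ)

/-- The four-point condition of hyperbolicity for a distance function. -/
def IsHyperbolicDist {X : Type*} (ρ : X → X → ℝ) : Prop :=
  ∃ δ : ℝ, 0 ≤ δ ∧ ∀ x y z w : X,
    ρ x y + ρ z w ≤ max (ρ x z + ρ y w) (ρ x w + ρ y z) + δ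

/-- A group is word-hyperbolic if it has a finite generating set whose word metric is
hyperbolic. -/
def IsWordHyperbolic (G : Type*) [Group G] : Prop :=
  ∃ T : Set G, T.Finite ∧ Subgroup.closure T = ⊤ ∧ IsHyperbolicDist (wordDist T)

/-! ## Unbounded operators and commutators -/

section Operators

variable {H : Type*} [NormedAddCommGroup H] [InnerProductSpace ℂ H]

/-- The commutator `[D, a] = D a - a D` of a partially defined operator `D` with a bounded
operator `a`, on its natural domain `{ξ ∈ dom D | a ξ ∈ dom D}`. -/
def diracCommutator (D : H →ₗ.[ℂ] H) (a : H →L[ℂ] H) : H →ₗ.[ℂ] H where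
  domain := D.domain ⊓ D.domain.comap a.toLinearMap
  toFun :=
    { toFun := fun ξ => D ⟨a ξ, ξ.2.2⟩ - a (D ⟨ξ, ξ.2.1⟩)
      map_add' := by
        intro ξ η
        have h1 : (⟨a ((ξ + η : _) : H), (ξ + η).2.2⟩ : D.domain)
            = ⟨a ξ, ξ.2.2⟩ + ⟨a η, η.2.2⟩ := Subtype.ext (by simp)
        have h2 : (⟨((ξ + η : _) : H), (ξ + η).2.1⟩ : D.domain)
            = ⟨ξ, ξ.2.1⟩ + ⟨η, η.2.1⟩ := Subtype.ext (by simp)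
        rw [h1, h2, D.map_add, D.map_add, map_add]
        abel
      map_smul' := by
        intro c ξ
        have h1 : (⟨a ((c • ξ : _) : H), (c • ξ).2.2⟩ : D.domain)
            = c • ⟨a ξ, ξ.2.2⟩ := Subtype.ext (by simp)
        have h2 : (⟨((c • ξ : _) : H), (c • ξ).2.1⟩ : D.domain)
            = c • ⟨ξ, ξ.2.1⟩ := Subtype.ext (by simp)
        rw [h1, h2, D.map_smul, D.map_smul, map_smul, smul_sub]
        rfl }

/-- The operator norm of a partially defined operator, with value `∞` if it is unbounded. -/
def pmapENorm (T : H →ₗ.[ℂ] H) : ℝ≥0∞ :=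
  ⨆ (ξ : T.domain) (_ : ‖(ξ : H)‖ ≤ 1), ‖T ξ‖ₑ

/-- The seminorm `L(a) = ‖[D, a]‖`. -/
def diracSeminorm (D : H →ₗ.[ℂ] H) (a : H →L[ℂ] H) : ℝ≥0∞ :=
  pmapENorm (diracCommutator D a)

end Operators

/-! ## State spaces and compact quantum metric spaces -/

/-- The state space of a unital `C*`-algebra, as a subset of the dual with the
weak-* topology: the positive functionals with value `1` at the unit. -/
def stateSpace (B : Type*) [NormedRing B] [StarRing B] [NormedAlgebra ℂ B] : Set (WeakDual ℂ B) :=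
  {φ | φ 1 = 1 ∧ ∀ b : B, 0 ≤ φ (star b * b)}

section QuantumMetric

variable {H : Type*} [NormedAddCommGroup H] [InnerProductSpace ℂ H] [CompleteSpace H]

/-- The states of the norm closure of a concrete pre-`C*`-algebra `A`. -/
abbrev States (A : StarSubalgebra ℂ (H →L[ℂ] H)) : Type _ :=
  stateSpace A.topologicalClosure

/-- The distance `ρ_L(μ, ν) = sup {|μ(a) - ν(a)| : a ∈ A, L(a) ≤ 1}` between states. -/
def stateDist (A : StarSubalgebra ℂ (H →L[ℂ] H)) (L : A → ℝ≥0∞) (μ ν : States A) : ℝ≥0∞ :=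
  ⨆ (a : A) (_ : L a ≤ 1),
    ‖μ.1 (StarSubalgebra.inclusion A.le_topologicalClosure a)
      - ν.1 (StarSubalgebra.inclusion A.le_topologicalClosure a)‖ₑ

/-- The extended metric structure on the state space given by `ρ_L`. Its topology is the one
generated by the open `ρ_L`-balls. -/
abbrev statePseudoEMetric (A : StarSubalgebra ℂ (H →L[ℂ] H)) (L : A → ℝ≥0∞) :
    PseudoEMetricSpace (States A) where
  edist := stateDist A L
  edist_self μ := by simp [stateDist]
  edist_comm μ ν := by
    simp only [stateDist]
    refine iSup_congr fun a => iSup_congr fun _ => ?_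
    rw [← enorm_neg, neg_sub]
  edist_triangle μ ν κ := by
    refine iSup₂_le fun a ha => ?_
    set b := StarSubalgebra.inclusion A.le_topologicalClosure a
    calc ‖μ.1 b - κ.1 b‖ₑ = ‖(μ.1 b - ν.1 b) + (ν.1 b - κ.1 b)‖ₑ := by
          rw [sub_add_sub_cancel]
      _ ≤ ‖μ.1 b - ν.1 b‖ₑ + ‖ν.1 b - κ.1 b‖ₑ := enorm_add_le _ _
      _ ≤ stateDist A L μ ν + stateDist A L ν κ :=
          add_le_add (le_iSup₂_of_le a ha le_rfl) (le_iSup₂_of_le a ha le_rfl)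

/-- The topology on the state space that comes from `ρ_L`. -/
@[reducible]
def stateMetricTopology (A : StarSubalgebra ℂ (H →L[ℂ] H)) (L : A → ℝ≥0∞) :
    TopologicalSpace (States A) :=
  (statePseudoEMetric A L).toUniformSpace.toTopologicalSpace

/-- The weak-* topology on the state space. -/
@[reducible]
def stateWeakStarTopology (A : StarSubalgebra ℂ (H →L[ℂ] H)) : TopologicalSpace (States A) :=
  instTopologicalSpaceSubtype

/-- `(A, L)` is a compact quantum metric space: `L` is a (finite) seminorm on the unital
pre-`C*`-algebra `A` that vanishes exactly on the scalars, and `ρ_L` induces the weak-*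
topology on the state space. -/
structure IsCompactQuantumMetricSpace (A : StarSubalgebra ℂ (H →L[ℂ] H))
    (L : A → ℝ≥0∞) : Prop where
  finite : ∀ a, L a < ∞
  add_le : ∀ a b, L (a + b) ≤ L a + L b
  smul_eq : ∀ (c : ℂ) (a), L (c • a) = ‖c‖ₑ * L a
  eq_zero_iff : ∀ a, L a = 0 ↔ ∃ c : ℂ, a = algebraMap ℂ A c
  topology_eq : stateMetricTopology A L = stateWeakStarTopology A

end QuantumMetric

/-! ## The reduced group `C*`-algebra and the operator `M_ℓ` -/

section ReducedGroupAlgebra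

/-- The Hilbert space `ℓ²(G)`. -/
abbrev EllTwo (G : Type*) : Type _ := lp (fun _ : G => ℂ) 2

/-- The operator of pointwise multiplication by a function `w` on `ℓ²(G)`, with domain
`{ξ ∈ ℓ²(G) | w ξ ∈ ℓ²(G)}`. -/
def mulOperator {G : Type*} (w : G → ℂ) : EllTwo G →ₗ.[ℂ] EllTwo G where
  domain :=
    { carrier := {ξ | Memℓp (fun x => w x * ξ x) 2}
      add_mem' := by
        intro ξ η hξ hη
        have h := Memℓp.add hξ hη
        refine (congrArg (fun f => Memℓp f 2) ?_).mp h
        funext x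
        simp [mul_add]
      zero_mem' := by
        refine (congrArg (fun f => Memℓp f 2) ?_).mp
          (zero_memℓp (E := fun _ : G => ℂ) (p := 2))
        funext x
        simp
      smul_mem' := by
        intro c ξ hξ
        have h := Memℓp.const_smul hξ c
        refine (congrArg (fun f => Memℓp f 2) ?_).mp h
        funext x
        simp [mul_left_comm] }
  toFun :=
    { toFun := fun ξ => ⟨fun x => w x * (ξ : EllTwo G) x, ξ.2⟩
      map_add' := by
        intro ξ η
        ext x
        exact mul_add _ _ _
      map_smul' := by
        intro c ξ
        ext x
        simp [mul_left_comm] }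

variable {G : Type*} [Group G]

/-- Left translation `(λ_g ξ)(x) = ξ(g⁻¹ x)` on `ℓ²(G)`, as a linear isometry. -/
def leftTranslation (g : G) : EllTwo G →ₗᵢ[ℂ] EllTwo G where
  toFun ξ := ⟨fun x => ξ (g⁻¹ * x), by
    have h := (memℓp_gen_iff (p := 2) (by norm_num)).mp (lp.memℓp ξ)
    exact memℓp_gen ((Equiv.mulLeft g⁻¹).summable_iff.mpr h)⟩
  map_add' ξ η := by
    ext x
    rfl
  map_smul' c ξ := by
    ext x
    simp
  norm_map' ξ := by
    have hp : 0 < (2 : ℝ≥0∞).toReal := by norm_num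
    rw [lp.norm_eq_tsum_rpow hp, lp.norm_eq_tsum_rpow hp]
    congr 1
    exact (Equiv.mulLeft g⁻¹).tsum_eq (fun x => ‖ξ x‖ ^ (2 : ℝ≥0∞).toReal)

theorem leftTranslation_apply (g : G) (ξ : EllTwo G) (x : G) :
    leftTranslation g ξ x = ξ (g⁻¹ * x) := rfl

variable (G) in
/-- The left regular representation of `G` on `ℓ²(G)` by bounded operators. -/
def leftRegular : G →* (EllTwo G →L[ℂ] EllTwo G) where
  toFun g := (leftTranslation g).toContinuousLinearMap
  map_one' := by
    ext ξ x
    simp [leftTranslation_apply]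
  map_mul' g h := by
    ext ξ x
    simp [leftTranslation_apply, mul_assoc]

theorem leftRegular_apply (g : G) (ξ : EllTwo G) (x : G) :
    leftRegular G g ξ x = ξ (g⁻¹ * x) := rfl

theorem star_leftRegular (g : G) : star (leftRegular G g) = leftRegular G g⁻¹ := by
  rw [ContinuousLinearMap.star_eq_adjoint]
  symm
  rw [ContinuousLinearMap.eq_adjoint_iff]
  intro ξ η
  have h : leftRegular G g (leftRegular G g⁻¹ ξ) = ξ := by
    rw [← mul_apply_eq_comp, ← map_mul, mul_inv_cancel, map_one]
    rfl
  have h' := (leftTranslation g).inner_map_map (leftRegular G g⁻¹ ξ) η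
  rw [← h']
  exact congrArg (fun ζ => inner ℂ ζ (leftRegular G g η)) h

variable (G) in
/-- The convolution algebra `C_c(G) = ℂ[G]` acting on `ℓ²(G)` by left convolution,
`f ↦ ∑ g, f(g) λ_g`. -/
def convolutionRep : MonoidAlgebra ℂ G →ₐ[ℂ] (EllTwo G →L[ℂ] EllTwo G) :=
  MonoidAlgebra.lift ℂ (EllTwo G →L[ℂ] EllTwo G) G (leftRegular G)

variable (G) in
/-- The `*`-algebra of all left convolution operators by finitely supported functions. -/
def convolutionOperators : StarSubalgebra ℂ (EllTwo G →L[ℂ] EllTwo G) where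
  toSubalgebra := (convolutionRep G).range
  star_mem' := by
    rintro _ ⟨f, rfl⟩
    change star (convolutionRep G f) ∈ (convolutionRep G).range
    induction f using MonoidAlgebra.induction_on with
    | of g =>
      refine ⟨MonoidAlgebra.of ℂ G g⁻¹, ?_⟩
      simp [convolutionRep, star_leftRegular]
    | add f₁ f₂ h₁ h₂ =>
      rw [map_add, star_add]
      exact add_mem h₁ h₂
    | smul c f h =>
      rw [map_smul, star_smul]
      exact Subalgebra.smul_mem _ h _

variable (G) in
/-- The reduced group `C*`-algebra of a discrete group. -/
abbrev ReducedGroupCStarAlgebra : StarSubalgebra ℂ (EllTwo G →L[ℂ] EllTwo G) :=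
  (convolutionOperators G).topologicalClosure

/-- The Dirac operator `M_ℓ`: multiplication by the word-length function of `S`. -/
def wordDirac (S : Set G) : EllTwo G →ₗ.[ℂ] EllTwo G :=
  mulOperator fun x => (wordLength S x : ℂ)

/-- The seminorm `L(f) = ‖[M_ℓ, f]‖` on the algebra of convolution operators. -/
def wordSeminorm (S : Set G) (a : convolutionOperators G) : ℝ≥0∞ :=
  diracSeminorm (wordDirac S) a.1

end ReducedGroupAlgebra

end

/-!
Write `ℓ` for the word length of `S` and `f` both for a finitely supported function and for the
operator of convolution by it. The core of the proof is that the unit ball of `L(f) = ‖[M_ℓ, f]‖`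
is totally bounded in the operator norm modulo scalars. By Rieffel's criterion
(`stateMetricTopology_eq`, `stateDist_lt_top`) this gives the statements on the metric `ρ_L`:
finitely many elements of `A` test the distance of two states up to a given error.

Total boundedness comes from a Haagerup inequality. Decompose `ℓ²(G)` into the shells
`{ℓ = n}`. Hyperbolicity implies (`haagerup_of_factorizations`) that for `f` supported on one shell
every matrix block of `f` between two shells has norm at most `c ‖f‖₂`, with `c` independent of
the shells. For general `f` let `f_k` be its shells. The part of `f` within `N` block diagonals then
has norm at most `(2 N + 1) c ∑ ‖f_k‖₂`, and the rest is obtained from `[M_ℓ, f]`, whose `j`-th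
block diagonal is `j` times that of `f`, by the Schur multiplier that is `1 / j` for `|j| > N`; the
Fourier series of this multiplier has `L²`-norm at most `√(2 / N)`, which bounds its multiplier
norm. Hence (`enorm_convolutionRep_le`)
`‖f‖ ≤ √(2 / N) L(f) + (2 N + 1) c ∑ ‖f_k‖₂`. Moreover `[M_ℓ, f] δ_1 = ℓ f` gives
`∑ k² ‖f_k‖₂² ≤ L(f)²`, so that the tail of `∑ ‖f_k‖₂` is small uniformly on the unit ball of `L`,
and up to a small error `‖f‖` is controlled by finitely many values of `f`, which are bounded
once `f(1) = 0` (`exists_finite_net_commutatorOp`).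

For the Haagerup inequality, every product `x y` is written as `x = c v`, `y = v⁻¹ w`, `x y = c w`
with `c` near the centre of the triangle `1, x, x y`. Once the three lengths are fixed, each of
`x`, `y` and `x y` leaves only boundedly many choices for its own factorization
(`exists_boundedly_many_factorizations`), and the Cauchy–Schwarz inequality for three
Hilbert–Schmidt kernels applies. Since hyperbolicity is only assumed for some generating set `T`,
the centre is found with the metric of `T`, and the half of the Morse lemma proved in
`exists_dist_quasigeodesic_le` puts it close to `S`-geodesics, which are quasi-geodesics for `T`.
-/

noncomputable section

/-! ### Word lengths -/

section WordLength

variable {G : Type*} [Group G] {S : Set G}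

theorem wordLength_le_length {w : List G} (hw : ∀ s ∈ w, s ∈ S ∨ s⁻¹ ∈ S) :
    wordLength S w.prod ≤ w.length :=
  Nat.sInf_le ⟨w, rfl, hw, rfl⟩

theorem exists_word_of_closure_eq_top (hS : Subgroup.closure S = ⊤) (g : G) :
    ∃ w : List G, (∀ s ∈ w, s ∈ S ∨ s⁻¹ ∈ S) ∧ w.prod = g := by
  have hg : g ∈ (Subgroup.closure S).toSubmonoid := hS ▸ Subgroup.mem_top g
  rw [Subgroup.closure_toSubmonoid] at hg
  exact Submonoid.exists_list_of_mem_closure hg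

theorem exists_minimal_word (hS : Subgroup.closure S = ⊤) (g : G) :
    ∃ w : List G, w.length = wordLength S g ∧ (∀ s ∈ w, s ∈ S ∨ s⁻¹ ∈ S) ∧ w.prod = g := by
  obtain ⟨w, hw, hp⟩ := exists_word_of_closure_eq_top hS g
  exact Nat.sInf_mem (s := {n : ℕ | ∃ w : List G, w.length = n ∧
    (∀ s ∈ w, s ∈ S ∨ s⁻¹ ∈ S) ∧ w.prod = g}) ⟨_, w, rfl, hw, hp⟩

@[simp]
theorem wordLength_one : wordLength S (1 : G) = 0 := by
  have := wordLength_le_length (S := S) (w := []) (by simp)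
  simpa using this

theorem wordLength_mul_le (hS : Subgroup.closure S = ⊤) (g h : G) :
    wordLength S (g * h) ≤ wordLength S g + wordLength S h := by
  obtain ⟨v, hv, hv', rfl⟩ := exists_minimal_word hS g
  obtain ⟨w, hw, hw', rfl⟩ := exists_minimal_word hS h
  rw [← hv, ← hw, ← List.prod_append, ← List.length_append]
  refine wordLength_le_length fun s hs => ?_
  rcases List.mem_append.mp hs with h | h
  exacts [hv' s h, hw' s h]

theorem wordLength_inv_le (hS : Subgroup.closure S = ⊤) (g : G) :
    wordLength S g⁻¹ ≤ wordLength S g := by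
  obtain ⟨w, hw, hw', rfl⟩ := exists_minimal_word hS g
  rw [← hw, List.prod_inv_reverse]
  refine (wordLength_le_length fun s hs => ?_).trans (by simp)
  simp only [List.mem_reverse, List.mem_map] at hs
  obtain ⟨t, ht, rfl⟩ := hs
  rw [inv_inv]
  exact (hw' t ht).symm

theorem wordLength_inv (hS : Subgroup.closure S = ⊤) (g : G) :
    wordLength S g⁻¹ = wordLength S g :=
  le_antisymm (wordLength_inv_le hS g) (by simpa using wordLength_inv_le hS g⁻¹)

theorem wordLength_eq_zero_iff (hS : Subgroup.closure S = ⊤) {g : G} :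
    wordLength S g = 0 ↔ g = 1 := by
  refine ⟨fun h => ?_, fun h => h ▸ wordLength_one⟩
  obtain ⟨w, hw, -, rfl⟩ := exists_minimal_word hS g
  rw [h, List.length_eq_zero_iff] at hw
  simp [hw]

/-- Prefixes of a minimal word form a geodesic from `1` to `g`. -/
theorem exists_geodesic (hS : Subgroup.closure S = ⊤) (g : G) :
    ∃ q : ℕ → G, q 0 = 1 ∧ q (wordLength S g) = g ∧
      ∀ i j, i ≤ j → j ≤ wordLength S g → wordLength S ((q i)⁻¹ * q j) = j - i := by
  obtain ⟨w, hw, hw', hp⟩ := exists_minimal_word hS g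
  set q : ℕ → G := fun i => (w.take i).prod with hq
  have hend : q (wordLength S g) = g := by simp [hq, ← hw, hp]
  have hle : ∀ i j, i ≤ j → wordLength S ((q i)⁻¹ * q j) ≤ j - i := by
    intro i j hij
    obtain ⟨k, rfl⟩ := Nat.exists_eq_add_of_le hij
    have h1 : (q i)⁻¹ * q (i + k) = ((w.drop i).take k).prod := by
      simp only [hq, List.take_add, List.prod_append, inv_mul_cancel_left]
    rw [h1]
    refine (wordLength_le_length fun s hs => hw' s ?_).trans (by simp)
    exact List.mem_of_mem_drop (List.mem_of_mem_take hs)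
  refine ⟨q, by simp [hq], hend, fun i j hij hj => le_antisymm (hle i j hij) ?_⟩
  -- the three pieces of the prefix path together have length at least that of `g`
  have h0 : q 0 = 1 := by simp [hq]
  have e1 := hle 0 i (Nat.zero_le _)
  have e2 := hle j _ hj
  have e3 := wordLength_mul_le hS (q i) ((q i)⁻¹ * q j)
  have e4 := wordLength_mul_le hS (q j) ((q j)⁻¹ * g)
  rw [hend] at e2
  rw [h0, inv_one, one_mul] at e1
  rw [mul_inv_cancel_left] at e3 e4
  omega

theorem finite_wordLength_le (hfin : S.Finite) (hS : Subgroup.closure S = ⊤) (n : ℕ) :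
    {g : G | wordLength S g ≤ n}.Finite := by
  have hT : {s : G | s ∈ S ∨ s⁻¹ ∈ S}.Finite :=
    hfin.union (hfin.preimage inv_injective.injOn)
  have := hT.to_subtype
  refine ((List.finite_length_le {s : G | s ∈ S ∨ s⁻¹ ∈ S} n).image
    fun w => (w.map Subtype.val).prod).subset fun g hg => ?_
  obtain ⟨w, hw, hw', rfl⟩ := exists_minimal_word hS g
  refine ⟨w.attach.map fun s => ⟨s.1, hw' s.1 s.2⟩, ?_, ?_⟩
  · simpa [hw] using hg
  · simp [Function.comp_def]

/-- Two finite generating sets have comparable word lengths. -/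
theorem exists_wordLength_le_mul {T : Set G} (hfin : S.Finite) (hS : Subgroup.closure S = ⊤)
    (hT : Subgroup.closure T = ⊤) :
    ∃ K : ℕ, 1 ≤ K ∧ ∀ g, wordLength T g ≤ K * wordLength S g := by
  obtain ⟨K, hK⟩ := (hfin.image (wordLength T)).bddAbove
  refine ⟨K + 1, by omega, fun g => ?_⟩
  obtain ⟨w, hw, hw', rfl⟩ := exists_minimal_word hS g
  rw [← hw]
  clear hw
  induction w with
  | nil => simp
  | cons s w ih =>
    have h1 := ih fun t ht => hw' t (by simp [ht])
    have h2 : wordLength T s ≤ K := by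
      rcases hw' s (by simp) with h | h
      · exact hK ⟨s, h, rfl⟩
      · rw [← wordLength_inv hT]
        exact hK ⟨_, h, rfl⟩
    have h3 := wordLength_mul_le hT s w.prod
    rw [List.prod_cons, List.length_cons, mul_add]
    omega

theorem abs_wordLength_sub_le (hS : Subgroup.closure S = ⊤) (u x : G) :
    |(wordLength S x : ℤ) - wordLength S (u⁻¹ * x)| ≤ wordLength S u := by
  have h1 := wordLength_mul_le hS u⁻¹ x
  have h2 := wordLength_mul_le hS u (u⁻¹ * x)
  rw [mul_inv_cancel_left] at h2
  rw [wordLength_inv hS] at h1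
  rw [abs_le]
  omega

end WordLength

/-! ### Hyperbolic metric spaces and quasi-geodesics -/

section Hyperbolic

variable {X : Type*} [PseudoMetricSpace X] {δ : ℝ}

/-- Twice the Gromov product of `x` and `y` with base point `p`. -/
def twoGromov (p x y : X) : ℝ := dist p x + dist p y - dist x y

theorem min_twoGromov_le
    (h4 : ∀ x y z w : X, dist x y + dist z w ≤ max (dist x z + dist y w) (dist x w + dist y z) + δ)
    (p x y z : X) : min (twoGromov p x z) (twoGromov p z y) - δ ≤ twoGromov p x y := by
  have h := h4 x y z p
  simp only [twoGromov]
  rw [dist_comm x p, dist_comm y p, dist_comm z p, dist_comm y z] at h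
  rcases max_cases (dist x z + dist p y) (dist p x + dist z y) with ⟨h1, -⟩ | ⟨h1, -⟩
  · have := min_le_left (dist p x + dist p z - dist x z) (dist p z + dist p y - dist z y)
    linarith
  · have := min_le_right (dist p x + dist p z - dist x z) (dist p z + dist p y - dist z y)
    linarith

/-- The Gromov product along a path of at most `2 ^ N` steps of size `≤ K` that stays outside
the ball of radius `n` about `p`: bisecting the path loses `δ` per halving. -/
theorem twoGromov_path_ge
    (h4 : ∀ x y z w : X, dist x y + dist z w ≤ max (dist x z + dist y w) (dist x w + dist y z) + δ)
    {p : X} {q : ℕ → X} {L : ℕ} {K n : ℝ} (hK : 0 ≤ K)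
    (hstep : ∀ i, i + 1 ≤ L → dist (q i) (q (i + 1)) ≤ K) (hn : ∀ i ≤ L, n ≤ dist p (q i))
    (N : ℕ) : ∀ i j, i ≤ j → j ≤ L → j - i ≤ 2 ^ N →
      2 * n - K - δ * N ≤ twoGromov p (q i) (q j) := by
  induction N with
  | zero =>
    intro i j hij hj h
    have h1 := hn i (hij.trans hj)
    have h2 := hn j hj
    have h3 : dist (q i) (q j) ≤ K := by
      rcases hij.eq_or_lt with rfl | hlt
      · simpa using hK
      · obtain rfl : j = i + 1 := by simp at h; omega
        exact hstep i hj
    simp only [twoGromov]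
    push_cast
    linarith
  | succ N ih =>
    intro i j hij hj h
    rw [pow_succ] at h
    obtain ⟨m, him, hmj, h1, h2⟩ : ∃ m, i ≤ m ∧ m ≤ j ∧ m - i ≤ 2 ^ N ∧ j - m ≤ 2 ^ N :=
      ⟨min j (i + 2 ^ N), by omega, by omega, by omega, by omega⟩
    have h3 := ih i m him (hmj.trans hj) h1
    have h4' := ih m j hmj hj h2
    have h5 := min_twoGromov_le h4 p (q i) (q j) (q m)
    have h6 := le_min h3 h4'
    push_cast
    linarith

/-- An exponential eventually beats a linear function. -/
theorem exists_forall_linear_lt_two_pow (a b : ℝ) : ∃ N₀ : ℕ, ∀ N ≥ N₀, a + b * N < 2 ^ N := by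
  have h1 : (fun _ : ℕ => a) =o[Filter.atTop] fun n : ℕ => (2 : ℝ) ^ n :=
    (Asymptotics.isLittleO_const_left.2 <| Or.inr <|
      (tendsto_norm_atTop_atTop.comp (tendsto_pow_atTop_atTop_of_one_lt one_lt_two)))
  have h2 : (fun n : ℕ => b * (n : ℝ)) =o[Filter.atTop] fun n : ℕ => (2 : ℝ) ^ n :=
    (isLittleO_coe_const_pow_of_one_lt (R := ℝ) one_lt_two).const_mul_left b
  have h3 := (h1.add h2).bound (c := 1 / 2) (by norm_num)
  obtain ⟨N₀, hN₀⟩ := Filter.eventually_atTop.1 h3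
  refine ⟨N₀, fun N hN => ?_⟩
  have h := hN₀ N hN
  have hpos : (0 : ℝ) < 2 ^ N := by positivity
  rw [Real.norm_of_nonneg hpos.le] at h
  have := Real.le_norm_self (a + b * N)
  linarith

/-- The half of the Morse lemma that is needed: every point `p` between the ends of a
quasi-geodesic is uniformly close to it. The bound comes from a point `p` at nearly maximal
distance: the quasi-geodesic then makes a detour around a ball about `p` of a radius comparable to
the length of the detour, which the logarithmic bound `twoGromov_path_ge` forbids for large
radii. -/
theorem exists_dist_quasigeodesic_le (hδ : 0 ≤ δ)
    (h4 : ∀ x y z w : X, dist x y + dist z w ≤ max (dist x z + dist y w) (dist x w + dist y z) + δ)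
    (hint : ∀ (x y : X) (n : ℕ), n ≤ dist x y → ∃ z, dist x z = n ∧ dist z y = dist x y - n)
    (K : ℕ) (hK : 1 ≤ K) :
    ∃ D : ℝ, 0 ≤ D ∧ ∀ (L : ℕ) (q : ℕ → X),
      (∀ i, i + 1 ≤ L → dist (q i) (q (i + 1)) ≤ K) →
      (∀ i j, i ≤ j → j ≤ L → ((j - i : ℕ) : ℝ) ≤ K * dist (q i) (q j)) →
      ∀ p, dist (q 0) p + dist p (q L) = dist (q 0) (q L) → ∃ i ≤ L, dist p (q i) ≤ D := by
  obtain ⟨N₀, hN₀⟩ := exists_forall_linear_lt_two_pow (6 * K * (K + 2 + δ * 2)) (6 * K * δ)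
  refine ⟨2 ^ N₀, by positivity, fun L q hstep hq p₀ hp₀ => ?_⟩
  classical
  set a := q 0
  set b := q L
  let P : ℕ → Prop := fun n => ∃ p, dist a p + dist p b = dist a b ∧ ∀ i ≤ L, (n : ℝ) ≤ dist p (q i)
  have hP0 : P 0 := ⟨p₀, hp₀, fun i _ => by simp⟩
  have hbound : ∀ n, P n → n ≤ ⌊dist a b⌋₊ := by
    rintro n ⟨p, hp, h⟩
    refine Nat.le_floor ((h 0 (Nat.zero_le _)).trans ?_)
    have := dist_nonneg (x := p) (y := b)
    rw [dist_comm p (q 0)]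
    linarith
  set n := Nat.findGreatest P ⌊dist a b⌋₊ with hn
  obtain ⟨p, hp, hfar⟩ : P n := Nat.findGreatest_spec (P := P) (Nat.zero_le _) hP0
  have hclose : ∀ p', dist a p' + dist p' b = dist a b → ∃ i ≤ L, dist p' (q i) < n + 1 := by
    intro p' hp'
    by_contra! hcon
    have hP : P (n + 1) := ⟨p', hp', by exact_mod_cast hcon⟩
    have := Nat.le_findGreatest (hbound _ hP) hP
    omega
  -- points `a'`, `b'` on either side of `p`, and points of the path near to them
  have hside : ∀ e : X, (e = a ∨ e = b) → ∃ e' i, i ≤ L ∧ dist e e' + dist e' p = dist e p ∧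
      2 * (n : ℝ) ≤ twoGromov p e' (q i) ∧ dist e' p ≤ 2 * n + 2 ∧ dist e' (q i) ≤ n + 1 := by
    intro e he
    obtain ⟨i₀, hi₀, hei₀⟩ : ∃ i ≤ L, q i = e := by
      rcases he with rfl | rfl
      exacts [⟨0, Nat.zero_le _, rfl⟩, ⟨L, le_rfl, rfl⟩]
    rcases le_total (((2 * n + 2 : ℕ) : ℝ)) (dist p e) with h | h
    · obtain ⟨e', h1, h2⟩ := hint p e (2 * n + 2) h
      have hbet : dist a e' + dist e' b = dist a b := by
        have t1 := dist_triangle a e' b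
        rcases he with rfl | rfl
        · have t2 := dist_triangle e' p b
          rw [dist_comm e' a] at h2
          rw [dist_comm e' p] at t2
          rw [dist_comm p a] at h2
          linarith
        · have t2 := dist_triangle a p e'
          linarith
      obtain ⟨i, hi, hd⟩ := hclose e' hbet
      refine ⟨e', i, hi, ?_, ?_, ?_, hd.le⟩
      · rw [dist_comm e e', dist_comm e' p, dist_comm e p]; linarith
      · have := hfar i hi
        simp only [twoGromov]
        rw [h1]; push_cast; linarith
      · rw [dist_comm, h1]; push_cast; linarith
    · refine ⟨e, i₀, hi₀, by simp, ?_, ?_, ?_⟩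
      · have := hfar i₀ hi₀
        rw [hei₀] at this ⊢
        simp only [twoGromov, dist_self]
        linarith
      · rw [dist_comm]; push_cast at h; exact h
      · rw [hei₀, dist_self]; positivity
  obtain ⟨a', i, hi, ha1, ha2, ha3, ha4⟩ := hside a (Or.inl rfl)
  obtain ⟨b', j, hj, hb1, hb2, hb3, hb4⟩ := hside b (Or.inr rfl)
  have hab : twoGromov p a' b' ≤ 0 := by
    simp only [twoGromov]
    have t1 := dist_triangle a a' b
    have t2 := dist_triangle a' b' b
    rw [dist_comm p a', dist_comm p b']
    rw [dist_comm b b', dist_comm b p] at hb1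
    linarith
  have hij : dist (q i) (q j) ≤ 6 * (n + 1) := by
    have t1 := dist_triangle4 (q i) a' b' (q j)
    have t2 := dist_triangle a' p b'
    rw [dist_comm (q i) a'] at t1
    rw [dist_comm p b'] at t2
    linarith
  have hmid : ∀ N : ℕ, 6 * K * (n + 1) ≤ 2 ^ N →
      2 * (n : ℝ) - K - δ * N ≤ twoGromov p (q i) (q j) := by
    intro N hN
    have key : ∀ i j, i ≤ j → j ≤ L → dist (q i) (q j) ≤ 6 * (n + 1) →
        2 * (n : ℝ) - K - δ * N ≤ twoGromov p (q i) (q j) := by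
      intro i j hij hj hd
      refine twoGromov_path_ge h4 (by positivity) hstep hfar N i j hij hj ?_
      refine le_trans ?_ hN
      have h1 := hq i j hij hj
      have h2 : ((j - i : ℕ) : ℝ) ≤ K * (6 * (n + 1)) :=
        h1.trans (by gcongr)
      have h3 : ((j - i : ℕ) : ℝ) ≤ ((6 * K * (n + 1) : ℕ) : ℝ) := by
        push_cast; linarith
      exact_mod_cast h3
    rcases le_total i j with h | h
    · exact key i j h hj hij
    · have := key j i h hi (by rwa [dist_comm])
      simp only [twoGromov] at this ⊢
      rw [dist_comm (q i)]
      linarith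
  have hmain : ∀ N : ℕ, 6 * K * (n + 1) ≤ 2 ^ N → 2 * (n : ℝ) ≤ K + δ * (N + 2) := by
    intro N hN
    have h1 := hmid N hN
    have h2 := min_twoGromov_le h4 p a' b' (q i)
    have h3 := min_twoGromov_le h4 p (q i) b' (q j)
    have hb2' : 2 * (n : ℝ) ≤ twoGromov p (q j) b' := by
      simp only [twoGromov] at hb2 ⊢
      rw [dist_comm (q j) b']
      linarith
    have hKN : (0 : ℝ) ≤ K + δ * N := by positivity
    have h4' : 2 * (n : ℝ) - K - δ * N ≤ min (twoGromov p (q i) (q j)) (twoGromov p (q j) b') :=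
      le_min h1 (by linarith)
    have h5 : 2 * (n : ℝ) - K - δ * N - δ ≤ min (twoGromov p a' (q i)) (twoGromov p (q i) b') :=
      le_min (by linarith) (by linarith)
    linarith
  have hex : ∃ N : ℕ, 6 * K * (n + 1) ≤ 2 ^ N := ⟨_, Nat.lt_two_pow_self.le⟩
  set N := Nat.find hex with hNdef
  have hN : 6 * K * (n + 1) ≤ 2 ^ N := Nat.find_spec hex
  have hNlt : N < N₀ + 1 := by
    by_contra! hcon
    obtain ⟨M, hM⟩ : ∃ M, N = M + 1 := ⟨N - 1, by omega⟩
    have h1 : ¬ 6 * K * (n + 1) ≤ 2 ^ M := Nat.find_min hex (by omega)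
    have h2 := hN₀ M (by omega)
    have h3 := hmain N hN
    rw [hM] at h3
    push_cast at h3
    have h4' : (2 : ℝ) ^ M < 6 * K * (n + 1) := by
      exact_mod_cast not_le.mp h1
    have hK' : (1 : ℝ) ≤ K := by exact_mod_cast hK
    have h5 : 6 * (K : ℝ) * (n + 1) ≤ 6 * K * ((K + δ * (M + 1 + 2)) / 2 + 1) := by
      gcongr; linarith
    have h6 : 0 ≤ 6 * (K : ℝ) * (K + δ * (M + 1)) := by positivity
    nlinarith
  obtain ⟨i₁, hi₁, hd₁⟩ := hclose p₀ hp₀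
  refine ⟨i₁, hi₁, hd₁.le.trans ?_⟩
  have h1 : 2 * (n + 1) ≤ 6 * K * (n + 1) := Nat.mul_le_mul_right _ (by omega)
  have h2 : 2 * (n + 1) ≤ 2 * 2 ^ N₀ := by
    calc 2 * (n + 1) ≤ 2 ^ N := h1.trans hN
      _ ≤ 2 ^ (N₀ + 1) := Nat.pow_le_pow_right (by norm_num) (by omega)
      _ = 2 * 2 ^ N₀ := by ring
  have h3 : n + 1 ≤ 2 ^ N₀ := by omega
  exact_mod_cast h3

/-- A point that is approximately between the ends of a quasi-geodesic is uniformly close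
to it: by the four-point condition it is close to a point exactly between the ends. -/
theorem exists_dist_quasigeodesic_le_of_approx (hδ : 0 ≤ δ)
    (h4 : ∀ x y z w : X, dist x y + dist z w ≤ max (dist x z + dist y w) (dist x w + dist y z) + δ)
    (hint : ∀ (x y : X) (n : ℕ), n ≤ dist x y → ∃ z, dist x z = n ∧ dist z y = dist x y - n)
    (K : ℕ) (hK : 1 ≤ K) (ε : ℝ) (hε : 0 ≤ ε) :
    ∃ D : ℝ, 0 ≤ D ∧ ∀ (L : ℕ) (q : ℕ → X),
      (∀ i, i + 1 ≤ L → dist (q i) (q (i + 1)) ≤ K) →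
      (∀ i j, i ≤ j → j ≤ L → ((j - i : ℕ) : ℝ) ≤ K * dist (q i) (q j)) →
      ∀ p, dist (q 0) p + dist p (q L) ≤ dist (q 0) (q L) + ε → ∃ i ≤ L, dist p (q i) ≤ D := by
  obtain ⟨D, hD0, hD⟩ := exists_dist_quasigeodesic_le hδ h4 hint K hK
  refine ⟨D + (2 + ε + δ), by positivity, fun L q hstep hq p hp => ?_⟩
  set a := q 0
  set b := q L
  set n := min ⌊dist a p⌋₊ ⌊dist a b⌋₊ with hn
  have hfl1 : (⌊dist a p⌋₊ : ℝ) ≤ dist a p := Nat.floor_le dist_nonneg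
  have hfl2 : (⌊dist a b⌋₊ : ℝ) ≤ dist a b := Nat.floor_le dist_nonneg
  have hfl3 := Nat.lt_floor_add_one (dist a p)
  have hfl4 := Nat.lt_floor_add_one (dist a b)
  have hn1 : (n : ℝ) ≤ dist a p := le_trans (by exact_mod_cast min_le_left _ _) hfl1
  have hn2 : (n : ℝ) ≤ dist a b := le_trans (by exact_mod_cast min_le_right _ _) hfl2
  have hn3 : dist a p ≤ n + 1 + ε := by
    have := dist_nonneg (x := p) (y := b)
    rcases min_choice ⌊dist a p⌋₊ ⌊dist a b⌋₊ with h | h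
    · rw [hn, h]; linarith
    · rw [hn, h]; linarith
  obtain ⟨p', h1, h2⟩ := hint a b n hn2
  obtain ⟨i, hi, hd⟩ := hD L q hstep hq p' (by change dist a p' + dist p' b = dist a b; linarith)
  refine ⟨i, hi, ?_⟩
  have h5 : dist p p' ≤ 2 + ε + δ := by
    have h6 := h4 p p' a b
    rw [dist_comm p a, dist_comm p' a] at h6
    rcases max_cases (dist a p + dist p' b) (dist p b + dist a p') with ⟨h7, -⟩ | ⟨h7, -⟩
    · linarith
    · linarith
  have := dist_triangle p p' (q i)
  linarith

/-- The point of `[x, y]` at distance the Gromov product from `x` is an approximate centre of the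
triangle `x, y, z`: it is approximately between any two of the vertices. -/
theorem exists_center (hδ : 0 ≤ δ)
    (h4 : ∀ x y z w : X, dist x y + dist z w ≤ max (dist x z + dist y w) (dist x w + dist y z) + δ)
    (hint : ∀ (x y : X) (n : ℕ), n ≤ dist x y → ∃ z, dist x z = n ∧ dist z y = dist x y - n)
    (x y z : X) :
    ∃ c, dist x c + dist c y ≤ dist x y + (δ + 2) ∧ dist x c + dist c z ≤ dist x z + (δ + 2) ∧
      dist y c + dist c z ≤ dist y z + (δ + 2) := by
  have hg0 : 0 ≤ twoGromov x y z / 2 := by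
    have := dist_triangle y x z
    rw [dist_comm y x] at this
    simp only [twoGromov]; linarith
  have hfl := Nat.floor_le hg0
  have hfl' := Nat.lt_floor_add_one (twoGromov x y z / 2)
  set n := ⌊twoGromov x y z / 2⌋₊
  have hle : (n : ℝ) ≤ dist x y := by
    have := dist_triangle x y z
    refine hfl.trans ?_
    simp only [twoGromov]; linarith
  obtain ⟨c, h1, h2⟩ := hint x y n hle
  simp only [twoGromov] at hfl hfl'
  have h3 := h4 c z x y
  rw [dist_comm c x, dist_comm z x, dist_comm z y] at h3
  refine ⟨c, by linarith, ?_, ?_⟩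
  · rcases max_cases (dist x c + dist y z) (dist c y + dist x z) with ⟨h7, -⟩ | ⟨h7, -⟩ <;> linarith
  · rw [dist_comm y c]
    rcases max_cases (dist x c + dist y z) (dist c y + dist x z) with ⟨h7, -⟩ | ⟨h7, -⟩ <;> linarith

end Hyperbolic

/-! ### Triangles in hyperbolic groups -/

section HyperbolicGroup

variable {G : Type*} [Group G] {S : Set G}

/-- The word metric as a metric space structure on the group. -/
abbrev wordMetricSpace (hS : Subgroup.closure S = ⊤) : PseudoMetricSpace G where
  dist := wordDist S
  dist_self x := by simp [wordDist]
  dist_comm x y := by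
    simp only [wordDist]
    rw [← wordLength_inv hS, mul_inv_rev, inv_inv]
  dist_triangle x y z := by
    simp only [wordDist]
    have := wordLength_mul_le hS (x⁻¹ * y) (y⁻¹ * z)
    rw [show x⁻¹ * y * (y⁻¹ * z) = x⁻¹ * z by group] at this
    exact_mod_cast this

theorem exists_wordDist_eq (hS : Subgroup.closure S = ⊤) (x y : G) (n : ℕ)
    (hn : (n : ℝ) ≤ wordDist S x y) :
    ∃ z, wordDist S x z = n ∧ wordDist S z y = wordDist S x y - n := by
  obtain ⟨q, h0, h1, h2⟩ := exists_geodesic hS (x⁻¹ * y)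
  simp only [wordDist] at hn ⊢
  have hn' : n ≤ wordLength S (x⁻¹ * y) := by exact_mod_cast hn
  refine ⟨x * q n, ?_, ?_⟩
  · have := h2 0 n (Nat.zero_le _) hn'
    rw [h0] at this
    simpa using this
  · have := h2 n _ hn' le_rfl
    rw [h1] at this
    rw [mul_inv_rev, mul_assoc, this, Nat.cast_sub hn']

/-- Hyperbolicity with respect to one finite generating set `T`, in the form that is used for
another finite generating set `S`: for every triangle `1, x, x y` there is a point `c` that is
uniformly close to any chosen `S`-geodesics for its three sides. -/
theorem exists_near_geodesics (hG : IsWordHyperbolic G) (hfin : S.Finite)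
    (hS : Subgroup.closure S = ⊤) :
    ∃ D : ℕ, ∀ γ : G → ℕ → G, (∀ g, γ g 0 = 1) → (∀ g, γ g (wordLength S g) = g) →
      (∀ g i j, i ≤ j → j ≤ wordLength S g → wordLength S ((γ g i)⁻¹ * γ g j) = j - i) →
      ∀ x y : G, ∃ c, (∃ i ≤ wordLength S x, wordLength S ((γ x i)⁻¹ * c) ≤ D) ∧
        (∃ i ≤ wordLength S y, wordLength S ((γ y i)⁻¹ * (x⁻¹ * c)) ≤ D) ∧
        (∃ i ≤ wordLength S (x * y), wordLength S ((γ (x * y) i)⁻¹ * c) ≤ D) := by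
  obtain ⟨T, hTfin, hT, δ, hδ, h4⟩ := hG
  let := wordMetricSpace hT
  have hdist : ∀ x y : G, dist x y = wordLength T (x⁻¹ * y) := fun _ _ => rfl
  have h4' : ∀ x y z w : G, dist x y + dist z w ≤
    max (dist x z + dist y w) (dist x w + dist y z) + δ := h4
  have hint : ∀ (x y : G) (n : ℕ), n ≤ dist x y → ∃ z, dist x z = n ∧ dist z y = dist x y - n :=
    exists_wordDist_eq hT
  obtain ⟨K₁, hK₁, hTS⟩ := exists_wordLength_le_mul hfin hS hT
  obtain ⟨K₂, hK₂, hST⟩ := exists_wordLength_le_mul hTfin hT hS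
  obtain ⟨D, hD0, hD⟩ := exists_dist_quasigeodesic_le_of_approx hδ h4' hint (max K₁ K₂)
    (le_max_of_le_left hK₁) (δ + 2) (by positivity)
  refine ⟨K₂ * ⌊D⌋₊, fun γ hγ0 hγ1 hγ x y => ?_⟩
  have main : ∀ h g c : G, dist h c + dist c (h * g) ≤ dist h (h * g) + (δ + 2) →
      ∃ i ≤ wordLength S g, wordLength S ((γ g i)⁻¹ * (h⁻¹ * c)) ≤ K₂ * ⌊D⌋₊ := by
    intro h g c hc
    have hq : ∀ i j, (h * γ g i)⁻¹ * (h * γ g j) = (γ g i)⁻¹ * γ g j := fun i j => by group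
    obtain ⟨i, hi, hd⟩ := hD (wordLength S g) (fun i => h * γ g i) (fun i hi => by
        rw [hdist, hq]
        have h1 := hTS ((γ g i)⁻¹ * γ g (i + 1))
        rw [hγ g i (i + 1) (Nat.le_succ _) hi, Nat.add_sub_cancel_left, mul_one] at h1
        exact_mod_cast h1.trans (le_max_left _ _))
      (fun i j hij hj => by
        rw [hdist, hq, ← hγ g i j hij hj]
        have h1 := hST ((γ g i)⁻¹ * γ g j)
        exact_mod_cast h1.trans (Nat.mul_le_mul_right _ (le_max_right _ _)))
      c (by simpa only [hγ0, hγ1, mul_one] using hc)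
    refine ⟨i, hi, ?_⟩
    rw [hdist] at hd
    have h1 : wordLength T (c⁻¹ * (h * γ g i)) ≤ ⌊D⌋₊ := Nat.le_floor hd
    rw [← wordLength_inv hS, show ((γ g i)⁻¹ * (h⁻¹ * c))⁻¹ = c⁻¹ * (h * γ g i) by group]
    exact (hST _).trans (Nat.mul_le_mul_left _ h1)
  obtain ⟨c, hc1, hc2, hc3⟩ := exists_center hδ h4' hint (1 : G) x (x * y)
  refine ⟨c, ?_, ?_, ?_⟩
  · simpa using main 1 x c (by simpa using hc1)
  · exact main x y c hc3
  · simpa using main 1 (x * y) c (by simpa using hc2)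

/-- The combinatorial form of hyperbolicity behind the Haagerup inequality. With every group
element `g` and every level `r` comes a set `N g r` of bounded size (the points close to a
geodesic `[1, g]` at distance about `r / 2` from `1`), such that every product `x y` factors as
`x = c v`, `y = v⁻¹ w`, `x y = c w` with `c ∈ N x r`, `v⁻¹ ∈ N y s`, `c ∈ N (x y) r`, where the
levels `r`, `s` only depend on the lengths of `x`, `y` and `x y`. -/
theorem exists_boundedly_many_factorizations (hG : IsWordHyperbolic G) (hfin : S.Finite)
    (hS : Subgroup.closure S = ⊤) :
    ∃ (C : ℕ) (N : G → ℤ → Finset G), (∀ g r, (N g r).card ≤ C) ∧ ∀ x y, ∃ c,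
      c ∈ N x (wordLength S x + wordLength S (x * y) - wordLength S y) ∧
      x⁻¹ * c ∈ N y (wordLength S x + wordLength S y - wordLength S (x * y)) ∧
      c ∈ N (x * y) (wordLength S x + wordLength S (x * y) - wordLength S y) := by
  classical
  obtain ⟨D, hD⟩ := exists_near_geodesics hG hfin hS
  choose γ hγ0 hγ1 hγ using exists_geodesic (S := S) hS
  set B : Finset G := (finite_wordLength_le hfin hS D).toFinset
  set I : G → ℤ → Finset ℕ := fun g r =>
    (Finset.range (wordLength S g + 1)).filter fun i => |2 * (i : ℤ) - r| ≤ 6 * D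
  refine ⟨(12 * D + 1) * B.card, fun g r => Finset.image₂ (fun i s => γ g i * s) (I g r) B,
    fun g r => ?_, fun x y => ?_⟩
  · refine (Finset.card_image₂_le _ _ _).trans (Nat.mul_le_mul_right _ ?_)
    have hmaps : ∀ i ∈ I g r, 2 * (i : ℤ) - r ∈ Finset.Icc (-(6 * D : ℤ)) (6 * D) := by
      intro i hi
      rw [Finset.mem_Icc, ← abs_le]
      exact (Finset.mem_filter.mp hi).2
    refine (Finset.card_le_card_of_injOn _ hmaps fun i _ j _ h => by simpa using h).trans ?_
    rw [Int.card_Icc]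
    omega
  · obtain ⟨c, ⟨i, hi, hi'⟩, ⟨j, hj, hj'⟩, ⟨l, hl, hl'⟩⟩ := hD γ hγ0 hγ1 hγ x y
    have mem : ∀ g c r k, k ≤ wordLength S g → |2 * (k : ℤ) - r| ≤ 6 * D →
        wordLength S ((γ g k)⁻¹ * c) ≤ D →
        c ∈ Finset.image₂ (fun i s => γ g i * s) (I g r) B := by
      intro g c r k hk hr hc
      refine Finset.mem_image₂.mpr ⟨k, ?_, (γ g k)⁻¹ * c, ?_, by group⟩
      · simp only [I, Finset.mem_filter, Finset.mem_range]
        exact ⟨by omega, hr⟩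
      · simpa [B] using hc
    -- compare the distances of `c` to the vertices with those of nearby points of the geodesics;
    -- each comparison costs `D`, and six of them give the width `6 D` of the levels in `I`
    have dist_ends : ∀ g c k, k ≤ wordLength S g → wordLength S ((γ g k)⁻¹ * c) ≤ D →
        |(wordLength S c : ℤ) - k| ≤ D ∧
        |(wordLength S (g⁻¹ * c) : ℤ) - (wordLength S g - k)| ≤ D := by
      intro g c k hk hc
      have e1 : wordLength S (γ g k) = k := by simpa [hγ0] using hγ g 0 k (Nat.zero_le _) hk
      have e2 : wordLength S (g⁻¹ * γ g k) = wordLength S g - k := by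
        rw [← wordLength_inv hS, mul_inv_rev, inv_inv]
        simpa [hγ1] using hγ g k _ hk le_rfl
      have h1 := wordLength_mul_le hS (γ g k) ((γ g k)⁻¹ * c)
      have h2 := wordLength_mul_le hS c (c⁻¹ * γ g k)
      have h3 := wordLength_mul_le hS (g⁻¹ * γ g k) ((γ g k)⁻¹ * c)
      have h4 := wordLength_mul_le hS (g⁻¹ * c) (c⁻¹ * γ g k)
      have h5 : wordLength S (c⁻¹ * γ g k) ≤ D := by
        rw [← wordLength_inv hS, mul_inv_rev, inv_inv]; exact hc
      rw [mul_inv_cancel_left] at h1 h2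
      rw [show g⁻¹ * γ g k * ((γ g k)⁻¹ * c) = g⁻¹ * c by group] at h3
      rw [show g⁻¹ * c * (c⁻¹ * γ g k) = g⁻¹ * γ g k by group] at h4
      rw [abs_le, abs_le]
      omega
    have a1 := dist_ends x c i hi hi'
    have a2 := dist_ends y (x⁻¹ * c) j hj hj'
    have a3 := dist_ends (x * y) c l hl hl'
    rw [show y⁻¹ * (x⁻¹ * c) = (x * y)⁻¹ * c by group] at a2
    simp only [abs_le] at a1 a2 a3
    exact ⟨c, mem x c _ i hi (by rw [abs_le]; omega) hi', mem y _ _ j hj (by rw [abs_le]; omega) hj',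
      mem _ c _ l hl (by rw [abs_le]; omega) hl'⟩

end HyperbolicGroup

/-! ### Square norms of extended nonnegative functions -/

section SquareNorm

/-- The `ℓ²`-norm of an extended nonnegative function. -/
def l2Norm {α : Type*} (f : α → ℝ≥0∞) : ℝ≥0∞ := (∑' x, f x ^ 2) ^ (1 / 2 : ℝ)

theorem l2Norm_sq {α : Type*} (f : α → ℝ≥0∞) : l2Norm f ^ 2 = ∑' x, f x ^ 2 := by
  rw [l2Norm, ← ENNReal.rpow_natCast, ← ENNReal.rpow_mul]
  norm_num

theorem ENNReal.le_of_sq_le_sq {a b : ℝ≥0∞} (h : a ^ 2 ≤ b ^ 2) : a ≤ b :=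
  (ENNReal.pow_le_pow_left_iff two_ne_zero).mp h

theorem tsum_mul_le_l2Norm {α : Type*} (f g : α → ℝ≥0∞) :
    ∑' x, f x * g x ≤ l2Norm f * l2Norm g := by
  rw [ENNReal.tsum_eq_iSup_sum]
  refine iSup_le fun s => ?_
  have h := ENNReal.inner_le_Lp_mul_Lq s f g Real.HolderConjugate.two_two
  refine h.trans (mul_le_mul' ?_ ?_) <;>
  · simp only [l2Norm, ENNReal.rpow_two]
    exact ENNReal.rpow_le_rpow (ENNReal.sum_le_tsum s) (by norm_num)

/-- The Hilbert–Schmidt bound for a trace of three kernels. -/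
theorem tsum_triple_le_l2Norm {α β γ : Type*} (F : α → β → ℝ≥0∞) (X : β → γ → ℝ≥0∞)
    (H : α → γ → ℝ≥0∞) :
    ∑' a, ∑' b, ∑' c, F a b * X b c * H a c ≤
      l2Norm (fun p : α × β => F p.1 p.2) * l2Norm (fun p : β × γ => X p.1 p.2) *
        l2Norm (fun p : α × γ => H p.1 p.2) := by
  have h1 : ∑' a, ∑' b, ∑' c, F a b * X b c * H a c =
      ∑' p : β × γ, X p.1 p.2 * ∑' a, F a p.1 * H a p.2 := by
    rw [ENNReal.tsum_prod (f := fun b c => X b c * ∑' a, F a b * H a c), ENNReal.tsum_comm]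
    refine tsum_congr fun b => ?_
    rw [ENNReal.tsum_comm]
    refine tsum_congr fun c => ?_
    rw [← ENNReal.tsum_mul_left]
    exact tsum_congr fun a => by ring
  have h2 : l2Norm (fun p : β × γ => ∑' a, F a p.1 * H a p.2) ≤
      l2Norm (fun p : α × β => F p.1 p.2) * l2Norm (fun p : α × γ => H p.1 p.2) := by
    refine ENNReal.le_of_sq_le_sq ?_
    rw [mul_pow, l2Norm_sq, l2Norm_sq, l2Norm_sq,
      ENNReal.tsum_prod (f := fun b c => (∑' a, F a b * H a c) ^ 2),
      ENNReal.tsum_prod (f := fun a b => F a b ^ 2), ENNReal.tsum_prod (f := fun a c => H a c ^ 2),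
      ENNReal.tsum_comm (f := fun a b => F a b ^ 2), ENNReal.tsum_comm (f := fun a c => H a c ^ 2),
      ← ENNReal.tsum_mul_right]
    refine ENNReal.tsum_le_tsum fun b => ?_
    rw [← ENNReal.tsum_mul_left]
    refine ENNReal.tsum_le_tsum fun c => ?_
    rw [← l2Norm_sq, ← l2Norm_sq, ← mul_pow]
    exact pow_le_pow_left' (tsum_mul_le_l2Norm _ _) 2
  rw [h1]
  refine (tsum_mul_le_l2Norm _ _).trans ?_
  rw [mul_comm (l2Norm _) (l2Norm fun p : β × γ => X p.1 p.2), mul_assoc]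
  gcongr

end SquareNorm

/-! ### The Haagerup inequality -/

section Haagerup

/-- The restriction of a function to the shell `{x | ℓ x = n}`. The index is an integer, so that
shifts of the index are harmless; shells of negative index are empty. -/
def shell {α : Type*} (ℓ : α → ℕ) (n : ℤ) (f : α → ℝ≥0∞) (x : α) : ℝ≥0∞ :=
  if (ℓ x : ℤ) = n then f x else 0

theorem tsum_shell {α : Type*} (ℓ : α → ℕ) (f : α → ℝ≥0∞) (x : α) :
    ∑' n, shell ℓ n f x = f x := by
  simp only [shell]
  rw [tsum_ite_eq']

theorem tsum_l2Norm_shell_sq {α : Type*} (ℓ : α → ℕ) (f : α → ℝ≥0∞) :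
    ∑' n, l2Norm (shell ℓ n f) ^ 2 = l2Norm f ^ 2 := by
  simp only [l2Norm_sq]
  rw [ENNReal.tsum_comm]
  refine tsum_congr fun x => ?_
  rw [← tsum_shell ℓ (fun x => f x ^ 2) x]
  refine tsum_congr fun n => ?_
  simp only [shell]
  split_ifs <;> simp

variable {G : Type*} [Group G]

/-- For a family of finite sets `N g` of bounded size, the kernel `(c, v) ↦ f (c v)`, restricted
to `c ∈ N (c v)`, is Hilbert–Schmidt. -/
theorem l2Norm_kernel_le {C : ℕ} {N : G → Finset G} (hN : ∀ g, (N g).card ≤ C)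
    (f : G → ℝ≥0∞) [∀ (c x : G), Decidable (c ∈ N x)] :
    l2Norm (fun p : G × G => if p.1 ∈ N (p.1 * p.2) then f (p.1 * p.2) else 0) ≤
      (C : ℝ≥0∞) ^ (1 / 2 : ℝ) * l2Norm f := by
  refine ENNReal.le_of_sq_le_sq ?_
  have hC : ((C : ℝ≥0∞) ^ (1 / 2 : ℝ)) ^ 2 = C := by
    rw [← ENNReal.rpow_natCast, ← ENNReal.rpow_mul]
    norm_num
  rw [mul_pow, l2Norm_sq, l2Norm_sq, hC]
  rw [ENNReal.tsum_prod (f := fun c v => (if c ∈ N (c * v) then f (c * v) else 0) ^ 2)]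
  have h1 : ∀ c, ∑' v, (if c ∈ N (c * v) then f (c * v) else 0) ^ 2 =
      ∑' x, (if c ∈ N x then f x else 0) ^ 2 := fun c =>
    (Equiv.mulLeft c).tsum_eq (fun x => (if c ∈ N x then f x else 0) ^ 2)
  simp only [h1]
  rw [ENNReal.tsum_comm, ← ENNReal.tsum_mul_left]
  refine ENNReal.tsum_le_tsum fun x => ?_
  rw [tsum_eq_sum (s := N x) (fun c hc => by simp [hc])]
  rw [Finset.sum_congr rfl (g := fun _ => f x ^ 2) (fun c hc => by simp [hc]), Finset.sum_const,
    nsmul_eq_mul]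
  gcongr
  exact hN x

/-- The Haagerup inequality from bounded factorizations: writing `x = c v`, `y = v⁻¹ w`,
`x y = c w` turns convolution into a product of three Hilbert–Schmidt kernels. -/
theorem haagerup_of_factorizations {C : ℕ} {N : G → ℤ → Finset G} (hN : ∀ g r, (N g r).card ≤ C)
    {ℓ : G → ℕ}
    (hfac : ∀ x y, ∃ c, c ∈ N x (ℓ x + ℓ (x * y) - ℓ y) ∧ x⁻¹ * c ∈ N y (ℓ x + ℓ y - ℓ (x * y)) ∧
      c ∈ N (x * y) (ℓ x + ℓ (x * y) - ℓ y)) (f ξ η : G → ℝ≥0∞) (k n m : ℤ) :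
    ∑' x, ∑' y, shell ℓ k f x * shell ℓ n ξ y * shell ℓ m η (x * y) ≤
      ((C : ℝ≥0∞) ^ (1 / 2 : ℝ)) ^ 3 * (l2Norm (shell ℓ k f) * l2Norm (shell ℓ n ξ) *
        l2Norm (shell ℓ m η)) := by
  classical
  set f' := shell ℓ k f
  set ξ' := shell ℓ n ξ
  set η' := shell ℓ m η
  set N₁ : G → Finset G := fun g => N g (k + m - n)
  set N₂ : G → Finset G := fun g => N g (k + n - m)
  set F : G → G → ℝ≥0∞ := fun c v => if c ∈ N₁ (c * v) then f' (c * v) else 0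
  set X : G → G → ℝ≥0∞ := fun u w => if u ∈ N₂ (u * w) then ξ' (u * w) else 0
  set H : G → G → ℝ≥0∞ := fun c w => if c ∈ N₁ (c * w) then η' (c * w) else 0
  have hX : l2Norm (fun p : G × G => X p.1⁻¹ p.2) = l2Norm (fun p : G × G => X p.1 p.2) := by
    simp only [l2Norm]
    congr 1
    exact ((Equiv.inv G).prodCongr (Equiv.refl G)).tsum_eq (fun p : G × G => X p.1 p.2 ^ 2)
  have h1 : ∑' x, ∑' y, f' x * ξ' y * η' (x * y) ≤
      ∑' c, ∑' v, ∑' w, F c v * X v⁻¹ w * H c w := by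
    set Φ : G → G → G → ℝ≥0∞ := fun c x y => (if c ∈ N₁ x then f' x else 0) *
      (if x⁻¹ * c ∈ N₂ y then ξ' y else 0) * (if c ∈ N₁ (x * y) then η' (x * y) else 0) with hΦ
    have e1 : ∀ c, ∑' v, ∑' w, F c v * X v⁻¹ w * H c w = ∑' x, ∑' y, Φ c x y := by
      intro c
      rw [← (Equiv.mulLeft c).tsum_eq (fun x => ∑' y, Φ c x y)]
      refine tsum_congr fun v => ?_
      rw [← (Equiv.mulLeft v⁻¹).tsum_eq (Φ c (Equiv.mulLeft c v))]
      refine tsum_congr fun w => ?_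
      simp only [Equiv.coe_mulLeft, F, X, H, Φ]
      rw [show c * v * (v⁻¹ * w) = c * w by group, show (c * v)⁻¹ * c = v⁻¹ by group]
    simp only [e1]
    rw [ENNReal.tsum_comm (f := fun c x => ∑' y, Φ c x y)]
    refine ENNReal.tsum_le_tsum fun x => ?_
    rw [ENNReal.tsum_comm (f := fun c y => Φ c x y)]
    refine ENNReal.tsum_le_tsum fun y => ?_
    by_cases hk : (ℓ x : ℤ) = k
    swap
    · simp [f', shell, hk]
    by_cases hn : (ℓ y : ℤ) = n
    swap
    · simp [ξ', shell, hn]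
    by_cases hm : (ℓ (x * y) : ℤ) = m
    swap
    · simp [η', shell, hm]
    obtain ⟨c, hc1, hc2, hc3⟩ := hfac x y
    rw [hk, hn, hm] at hc1 hc2 hc3
    refine le_trans (le_of_eq ?_) (ENNReal.le_tsum c)
    simp only [hΦ]
    rw [if_pos hc1, if_pos hc2, if_pos hc3]
  refine h1.trans ((tsum_triple_le_l2Norm F (fun v w => X v⁻¹ w) H).trans ?_)
  rw [hX]
  have hF := l2Norm_kernel_le (fun g => hN g (k + m - n)) f'
  have hX := l2Norm_kernel_le (fun g => hN g (k + n - m)) ξ'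
  have hH := l2Norm_kernel_le (fun g => hN g (k + m - n)) η'
  calc _ ≤ _ := mul_le_mul' (mul_le_mul' hF hX) hH
    _ = _ := by ring

/-- The part of a convolution operator within `N` diagonals of the decomposition of `ℓ²(G)` into
shells is bounded by the sum of the `ℓ²`-norms of the shells of its symbol. -/
theorem band_le {c : ℝ≥0∞} {ℓ : G → ℕ}
    (hH : ∀ (f ξ η : G → ℝ≥0∞) (k n m : ℤ),
      ∑' x, ∑' y, shell ℓ k f x * shell ℓ n ξ y * shell ℓ m η (x * y) ≤
      c * (l2Norm (shell ℓ k f) * l2Norm (shell ℓ n ξ) * l2Norm (shell ℓ m η)))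
    (N : ℕ) (f ξ η : G → ℝ≥0∞) :
    ∑' x, ∑' y, (if |(ℓ (x * y) : ℤ) - ℓ y| ≤ N then f x * ξ y * η (x * y) else 0) ≤
      (2 * N + 1) * c * (∑' k, l2Norm (shell ℓ k f)) * (l2Norm ξ * l2Norm η) := by
  have hdiag : ∀ j : ℤ, ∑' x, ∑' y, (if (ℓ (x * y) : ℤ) - ℓ y = j then f x * ξ y * η (x * y)
      else 0) ≤ c * (∑' k, l2Norm (shell ℓ k f)) * (l2Norm ξ * l2Norm η) := by
    intro j
    have e1 : ∑' x, ∑' y, (if (ℓ (x * y) : ℤ) - ℓ y = j then f x * ξ y * η (x * y) else 0) =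
        ∑' k, ∑' n, ∑' x, ∑' y, shell ℓ k f x * shell ℓ n ξ y * shell ℓ (n + j) η (x * y) := by
      have e2 : ∀ x y, (if (ℓ (x * y) : ℤ) - ℓ y = j then f x * ξ y * η (x * y) else 0) =
          ∑' k, ∑' n, shell ℓ k f x * shell ℓ n ξ y * shell ℓ (n + j) η (x * y) := by
        intro x y
        have e3 : ∀ n, shell ℓ n ξ y * shell ℓ (n + j) η (x * y) =
            if (ℓ y : ℤ) = n then
              (if (ℓ (x * y) : ℤ) - ℓ y = j then ξ y * η (x * y) else 0) else 0 := by
          intro n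
          simp only [shell]
          by_cases h : (ℓ y : ℤ) = n
          · have h' : ((ℓ (x * y) : ℤ) = n + j) ↔ (ℓ (x * y) : ℤ) - ℓ y = j := by omega
            simp only [h, h', if_true]
            simp only [← h]
            split_ifs <;> simp
          · simp [h]
        simp only [mul_assoc, e3, ENNReal.tsum_mul_left, ENNReal.tsum_mul_right, tsum_shell]
        rw [tsum_ite_eq']
        split_ifs <;> simp
      simp only [e2]
      rw [tsum_congr fun x => ENNReal.tsum_comm (f := fun y k => ∑' n,
        shell ℓ k f x * shell ℓ n ξ y * shell ℓ (n + j) η (x * y)), ENNReal.tsum_comm]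
      refine tsum_congr fun k => ?_
      rw [tsum_congr fun x => ENNReal.tsum_comm, ENNReal.tsum_comm]
    rw [e1, ← ENNReal.tsum_mul_left, ← ENNReal.tsum_mul_right]
    refine ENNReal.tsum_le_tsum fun k => ?_
    have e4 : ∑' n, l2Norm (shell ℓ n ξ) * l2Norm (shell ℓ (n + j) η) ≤ l2Norm ξ * l2Norm η := by
      refine (tsum_mul_le_l2Norm _ _).trans (mul_le_mul' ?_ ?_) <;> refine ENNReal.le_of_sq_le_sq ?_
      · rw [l2Norm_sq, tsum_l2Norm_shell_sq]
      · rw [l2Norm_sq, ← tsum_l2Norm_shell_sq ℓ η]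
        exact ((Equiv.addRight j).tsum_eq (fun n => l2Norm (shell ℓ n η) ^ 2)).le
    refine (ENNReal.tsum_le_tsum fun n => hH f ξ η k n (n + j)).trans ?_
    simp only [mul_assoc, ENNReal.tsum_mul_left]
    gcongr
  have e5 : ∀ x y, (if |(ℓ (x * y) : ℤ) - ℓ y| ≤ N then f x * ξ y * η (x * y) else 0) =
      ∑ j ∈ Finset.Icc (-(N : ℤ)) N,
        (if (ℓ (x * y) : ℤ) - ℓ y = j then f x * ξ y * η (x * y) else 0) := by
    intro x y
    rw [Finset.sum_ite_eq]
    simp only [Finset.mem_Icc, abs_le]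
  have e6 : ∀ x, ∑' y, ∑ j ∈ Finset.Icc (-(N : ℤ)) N,
        (if (ℓ (x * y) : ℤ) - ℓ y = j then f x * ξ y * η (x * y) else 0) =
      ∑ j ∈ Finset.Icc (-(N : ℤ)) N, ∑' y,
        (if (ℓ (x * y) : ℤ) - ℓ y = j then f x * ξ y * η (x * y) else 0) := fun x =>
    Summable.tsum_finsetSum fun _ _ => ENNReal.summable
  simp only [e5, e6]
  rw [Summable.tsum_finsetSum fun _ _ => ENNReal.summable]
  refine (Finset.sum_le_sum fun j _ => hdiag j).trans ?_
  rw [Finset.sum_const, Int.card_Icc, nsmul_eq_mul,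
    show ((N : ℤ) + 1 - -(N : ℤ)).toNat = 2 * N + 1 by omega]
  push_cast
  simp only [mul_assoc]
  exact le_rfl

end Haagerup

/-! ### Finitely supported multipliers and characters of finite cyclic groups -/

section Fourier

open Finset

/-- A finitely supported multiplier is a combination of characters whose coefficients are bounded
in `ℓ¹` by the `ℓ²`-norm of the multiplier. The characters come from `ℤ/(2R+1)ℤ`, into which the
window `[-R, R]` embeds. -/
theorem exists_character_expansion (c : ℤ → ℂ) (R : ℕ) :
    ∃ (ι : Type) (_ : Fintype ι) (φ : ι → ℂ) (e : ι → ℤ → ℂ),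
      (∀ r i, ‖e r i‖ = 1) ∧ (∀ r i j, e r (i - j) = e r i * star (e r j)) ∧
      (∀ j, |j| ≤ (R : ℤ) → ∑ r, φ r * e r j = c j) ∧
      ∑ r, ‖φ r‖ ≤ √(∑ j ∈ Icc (-R : ℤ) R, ‖c j‖ ^ 2) := by
  set M : ℕ := 2 * R + 1 with hM
  set W := Icc (-R : ℤ) R
  set e : ZMod M → ℤ → ℂ := fun r j => ZMod.stdAddChar (r * (j : ZMod M)) with he
  have he1 : ∀ r i, ‖e r i‖ = 1 := fun r i => by
    simp only [he, ZMod.stdAddChar_apply, Circle.norm_coe]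
  have hsub : ∀ r i j, e r (i - j) = e r i * star (e r j) := by
    intro r i j
    simp only [he]
    rw [show r * ((i - j : ℤ) : ZMod M) = r * i + -(r * j) by push_cast; ring,
      AddChar.map_add_eq_mul, AddChar.map_neg_eq_conj]
    rfl
  have horth : ∀ j, |j| ≤ 2 * (R : ℤ) → ∑ r, e r j = if j = 0 then (M : ℂ) else 0 := by
    intro j hj
    have h1 := AddChar.sum_mulShift (j : ZMod M) (ZMod.isPrimitive_stdAddChar M)
    simp only [he]
    rw [h1, ZMod.card]
    have h2 : ((j : ZMod M) = 0) ↔ j = 0 := by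
      rw [ZMod.intCast_zmod_eq_zero_iff_dvd]
      refine ⟨fun h => ?_, fun h => by simp [h]⟩
      refine Int.eq_zero_of_abs_lt_dvd h ?_
      push_cast [hM]
      omega
    simp only [h2]
    split_ifs <;> simp
  have hMpos : (0 : ℝ) < M := by positivity
  have hM0 : (M : ℂ) ≠ 0 := by exact_mod_cast hMpos.ne'
  have horthW : ∀ i ∈ W, ∀ j ∈ W, ∑ r, e r (i - j) = if i = j then (M : ℂ) else 0 := by
    intro i hi j hj
    rw [mem_Icc] at hi hj
    rw [horth (i - j) (by rw [abs_le]; omega)]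
    simp only [sub_eq_zero]
  set φ : ZMod M → ℂ := fun r => (M : ℂ)⁻¹ * ∑ i ∈ W, c i * star (e r i) with hφ
  refine ⟨ZMod M, inferInstance, φ, e, he1, hsub, fun j hj => ?_, ?_⟩
  · have hjW : j ∈ W := by rw [mem_Icc, ← abs_le]; exact hj
    calc ∑ r, φ r * e r j = (M : ℂ)⁻¹ * ∑ i ∈ W, c i * ∑ r, e r (j - i) := by
          simp only [hφ, mul_sum, sum_mul, hsub]
          rw [sum_comm]
          exact sum_congr rfl fun i _ => sum_congr rfl fun r _ => by ring
      _ = (M : ℂ)⁻¹ * ∑ i ∈ W, c i * (if j = i then (M : ℂ) else 0) := by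
          congr 1
          exact sum_congr rfl fun i hi => by rw [horthW j hjW i hi]
      _ = c j := by
          simp only [mul_ite, mul_zero]
          rw [sum_ite_eq, if_pos hjW]
          field_simp
  · have hpars : ∑ r, ‖φ r‖ ^ 2 = (M : ℝ)⁻¹ * ∑ i ∈ W, ‖c i‖ ^ 2 := by
      have : ((∑ r, ‖φ r‖ ^ 2 : ℝ) : ℂ) = ((M : ℝ)⁻¹ * ∑ i ∈ W, ‖c i‖ ^ 2 : ℝ) := by
        push_cast
        calc ∑ r, ((‖φ r‖ : ℂ)) ^ 2
            = ∑ r, (M : ℂ)⁻¹ * (M : ℂ)⁻¹ * ∑ i ∈ W, ∑ j ∈ W, c i * star (c j) * e r (j - i) := by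
              refine sum_congr rfl fun r _ => ?_
              rw [← Complex.mul_conj']
              simp only [hφ, map_mul, map_sum, map_inv₀, map_natCast, hsub, starRingEnd_apply,
                star_star]
              rw [mul_mul_mul_comm, sum_mul_sum]
              congr 1
              exact sum_congr rfl fun i _ => sum_congr rfl fun j _ => by ring
          _ = (M : ℂ)⁻¹ * (M : ℂ)⁻¹ * ∑ i ∈ W, ∑ j ∈ W, c i * star (c j) * ∑ r, e r (j - i) := by
              rw [← mul_sum, sum_comm]
              congr 1
              refine sum_congr rfl fun i _ => ?_
              rw [sum_comm]
              exact sum_congr rfl fun j _ => by rw [mul_sum]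
          _ = (M : ℂ)⁻¹ * (M : ℂ)⁻¹ * ∑ i ∈ W, (c i * star (c i)) * M := by
              congr 1
              refine sum_congr rfl fun i hi => ?_
              rw [sum_congr rfl fun j hj => by rw [horthW j hj i hi]]
              simp only [mul_ite, mul_zero]
              rw [sum_ite_eq', if_pos hi]
          _ = (M : ℂ)⁻¹ * ∑ i ∈ W, (‖c i‖ : ℂ) ^ 2 := by
              rw [← sum_mul]
              simp only [← Complex.mul_conj', starRingEnd_apply]
              field_simp
      exact_mod_cast this
    refine Real.le_sqrt_of_sq_le ?_
    have h1 := sq_sum_le_card_mul_sum_sq (s := univ) (f := fun r => ‖φ r‖)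
    rw [hpars, card_univ, ZMod.card] at h1
    refine h1.trans (le_of_eq ?_)
    field_simp

/-- The squared `ℓ²`-norm of `1 / j` outside of `[-N, N]` is at most `2 / N`. -/
theorem sum_inv_sq_outside_le {N : ℕ} (hN : N ≠ 0) (R : ℕ) :
    ∑ j ∈ Icc (-R : ℤ) R, ‖(if |j| ≤ (N : ℤ) then 0 else (j : ℂ)⁻¹)‖ ^ 2 ≤ 2 / N := by
  have h0 : ∀ j : ℤ, ‖(if |j| ≤ (N : ℤ) then 0 else (j : ℂ)⁻¹)‖ ^ 2 =
      if |j| ≤ (N : ℤ) then (0 : ℝ) else ((j : ℝ) ^ 2)⁻¹ := by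
    intro j
    split_ifs
    · simp
    · simp
  simp only [h0]
  have h1 : ∑ i ∈ Ioc N (max N R), ((i : ℝ) ^ 2)⁻¹ ≤ (N : ℝ)⁻¹ := by
    refine (sum_Ioc_inv_sq_le_sub hN (le_max_left _ _)).trans ?_
    have : (0 : ℝ) ≤ ((max N R : ℕ) : ℝ)⁻¹ := by positivity
    linarith
  have hsubset : (Icc (-R : ℤ) R).filter (fun j => ¬ |j| ≤ (N : ℤ)) ⊆
      ((Ioc N (max N R)).image fun i : ℕ => (i : ℤ)) ∪
        ((Ioc N (max N R)).image fun i : ℕ => -(i : ℤ)) := by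
    intro j hj
    rw [mem_filter, mem_Icc, abs_le] at hj
    rw [mem_union, mem_image, mem_image]
    rcases le_total 0 j with h | h
    · exact Or.inl ⟨j.natAbs, by rw [mem_Ioc]; omega, by omega⟩
    · exact Or.inr ⟨j.natAbs, by rw [mem_Ioc]; omega, by omega⟩
  calc ∑ j ∈ Icc (-R : ℤ) R, (if |j| ≤ (N : ℤ) then (0 : ℝ) else ((j : ℝ) ^ 2)⁻¹)
      = ∑ j ∈ (Icc (-R : ℤ) R).filter (fun j => ¬ |j| ≤ (N : ℤ)), ((j : ℝ) ^ 2)⁻¹ := by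
        rw [sum_filter]
        exact sum_congr rfl fun j _ => by split_ifs <;> simp_all
    _ ≤ ∑ j ∈ ((Ioc N (max N R)).image fun i : ℕ => (i : ℤ)) ∪
          ((Ioc N (max N R)).image fun i : ℕ => -(i : ℤ)), ((j : ℝ) ^ 2)⁻¹ :=
        sum_le_sum_of_subset_of_nonneg hsubset fun _ _ _ => by positivity
    _ ≤ ∑ j ∈ (Ioc N (max N R)).image (fun i : ℕ => (i : ℤ)), ((j : ℝ) ^ 2)⁻¹ +
          ∑ j ∈ (Ioc N (max N R)).image (fun i : ℕ => -(i : ℤ)), ((j : ℝ) ^ 2)⁻¹ := by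
        rw [← sum_union_inter]
        exact le_add_of_nonneg_right (sum_nonneg fun _ _ => by positivity)
    _ ≤ (N : ℝ)⁻¹ + (N : ℝ)⁻¹ := by
        rw [sum_image (by intro a _ b _ h; simpa using h),
          sum_image (by intro a _ b _ h; simpa using h)]
        simp only [Int.cast_neg, Int.cast_natCast, neg_sq]
        exact add_le_add h1 h1
    _ = 2 / N := by ring

end Fourier

/-! ### Bounded multiplication operators -/

section EllTwoNorm

variable {α : Type*}

theorem enorm_eq_l2Norm (ξ : EllTwo α) : ‖ξ‖ₑ = l2Norm (fun x => ‖ξ x‖ₑ) := by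
  have h1 : ‖ξ‖ ^ 2 = ∑' x, ‖ξ x‖ ^ 2 := by
    have := lp.norm_rpow_eq_tsum (p := 2) (by norm_num) ξ
    simpa using this
  have h2 : Summable fun x => ‖ξ x‖ ^ 2 := by
    have := (lp.memℓp ξ).summable (by norm_num)
    simpa using this
  have h3 : ‖ξ‖ₑ ^ 2 = l2Norm (fun x => ‖ξ x‖ₑ) ^ 2 := by
    rw [l2Norm_sq, ← ofReal_norm, ← ENNReal.ofReal_pow (norm_nonneg _), h1,
      ENNReal.ofReal_tsum_of_nonneg (fun _ => by positivity) h2]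
    exact tsum_congr fun x => by rw [ENNReal.ofReal_pow (norm_nonneg _), ofReal_norm]
  exact le_antisymm (ENNReal.le_of_sq_le_sq h3.le) (ENNReal.le_of_sq_le_sq h3.ge)

theorem memℓp_bounded_mul {w : α → ℂ} {C : ℝ} (hw : ∀ x, ‖w x‖ ≤ C) (ξ : EllTwo α) :
    Memℓp (fun x => w x * ξ x) 2 := by
  have h2 : Summable fun x => ‖ξ x‖ ^ 2 := by
    have := (lp.memℓp ξ).summable (by norm_num)
    simpa using this
  refine memℓp_gen ?_
  simp only [ENNReal.toReal_ofNat, Real.rpow_ofNat]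
  refine Summable.of_nonneg_of_le (fun _ => by positivity) (fun x => ?_) (h2.mul_left (C ^ 2))
  rw [norm_mul, mul_pow]
  gcongr
  exact hw x

/-- The bounded operator of multiplication by a function with `|w| ≤ C` on `ℓ²`. -/
def boundedMul (w : α → ℂ) (C : ℝ) (hw : ∀ x, ‖w x‖ ≤ C) : EllTwo α →L[ℂ] EllTwo α :=
  LinearMap.mkContinuous
    { toFun := fun ξ => ⟨fun x => w x * ξ x, memℓp_bounded_mul hw ξ⟩
      map_add' := fun ξ η => by
        ext x
        exact mul_add _ _ _
      map_smul' := fun c ξ => by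
        ext x
        simp [mul_left_comm] } |C| (fun ξ => by
    rw [← ENNReal.ofReal_le_ofReal_iff (by positivity), ENNReal.ofReal_mul (abs_nonneg _),
      ofReal_norm, ofReal_norm, enorm_eq_l2Norm, enorm_eq_l2Norm]
    refine ENNReal.le_of_sq_le_sq ?_
    rw [mul_pow, l2Norm_sq, l2Norm_sq, ← ENNReal.tsum_mul_left]
    refine ENNReal.tsum_le_tsum fun x => ?_
    rw [← mul_pow]
    refine pow_le_pow_left' ?_ 2
    change ‖w x * ξ x‖ₑ ≤ _
    rw [enorm_mul]
    gcongr
    rw [← ofReal_norm]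
    exact ENNReal.ofReal_le_ofReal ((hw x).trans (le_abs_self C)))

theorem boundedMul_apply (w : α → ℂ) (C : ℝ) (hw : ∀ x, ‖w x‖ ≤ C) (ξ : EllTwo α) (x : α) :
    boundedMul w C hw ξ x = w x * ξ x := rfl

theorem enorm_boundedMul_le_one (w : α → ℂ) (hw : ∀ x, ‖w x‖ ≤ 1) :
    ‖boundedMul w 1 hw‖ₑ ≤ 1 := by
  have : ‖boundedMul w 1 hw‖ ≤ |1| := LinearMap.mkContinuous_norm_le _ (abs_nonneg _) _
  rw [← ofReal_norm]
  exact (ENNReal.ofReal_le_ofReal this).trans (by simp)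

theorem EllTwo.sum_apply {ι : Type*} (s : Finset ι) (ξ : ι → EllTwo α) (x : α) :
    (∑ i ∈ s, ξ i) x = ∑ i ∈ s, ξ i x := by
  rw [lp.coeFn_sum, Finset.sum_apply]

/-- Finitely supported vectors lie in the domain of every multiplication operator. -/
theorem dense_mulOperator_domain (w : α → ℂ) :
    Dense ((mulOperator w).domain : Set (EllTwo α)) := by
  classical
  intro ξ
  have h := lp.hasSum_single (p := 2) (by norm_num) ξ
  refine mem_closure_of_tendsto h (Filter.Eventually.of_forall fun s => ?_)
  refine Submodule.sum_mem _ fun i _ => ?_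
  change Memℓp (fun x => w x * (lp.single 2 i (ξ i) : EllTwo α) x) 2
  refine (congrArg (fun f => Memℓp f 2) ?_).mp (lp.memℓp (lp.single 2 i (w i * ξ i) : EllTwo α))
  funext x
  by_cases hx : x = i
  · subst hx
    simp
  · simp [hx]

end EllTwoNorm

/-! ### Norms of partially defined operators -/

section PMap

variable {H : Type*} [NormedAddCommGroup H] [InnerProductSpace ℂ H]

theorem enorm_apply_le_pmapENorm (T : H →ₗ.[ℂ] H) (ξ : T.domain) :
    ‖T ξ‖ₑ ≤ pmapENorm T * ‖(ξ : H)‖ₑ := by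
  by_cases h0 : (ξ : H) = 0
  · have : ξ = 0 := Subtype.ext h0
    subst this
    simp
  have hpos : 0 < ‖(ξ : H)‖ := norm_pos_iff.mpr h0
  set c : ℂ := ((‖(ξ : H)‖⁻¹ : ℝ) : ℂ) with hc
  have hcn : ‖c‖ = ‖(ξ : H)‖⁻¹ := by simp [hc]
  have h1 : ‖T (c • ξ)‖ₑ ≤ pmapENorm T := by
    refine le_iSup₂_of_le (c • ξ) ?_ le_rfl
    rw [Submodule.coe_smul, norm_smul, hcn, inv_mul_cancel₀ hpos.ne']
  have h2 : T ξ = ((‖(ξ : H)‖ : ℝ) : ℂ) • T (c • ξ) := by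
    rw [T.map_smul, smul_smul, hc, ← Complex.ofReal_mul, mul_inv_cancel₀ hpos.ne']
    simp
  rw [h2, enorm_smul, mul_comm]
  gcongr
  simp [← ofReal_norm]

end PMap

/-! ### Commutators with the multiplication by a word length -/

section Commutator

variable {G : Type*} [Group G]

theorem convolutionRep_eq_sum (g : MonoidAlgebra ℂ G) :
    convolutionRep G g = ∑ u ∈ g.coeff.support, g.coeff u • leftRegular G u := by
  rw [convolutionRep, MonoidAlgebra.lift_apply]
  rfl

theorem convolutionRep_apply (g : MonoidAlgebra ℂ G) (ξ : EllTwo G) (x : G) :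
    convolutionRep G g ξ x = ∑ u ∈ g.coeff.support, g.coeff u * ξ (u⁻¹ * x) := by
  rw [convolutionRep_eq_sum, sum_apply, EllTwo.sum_apply]
  rfl

/-- The increment `x ↦ ℓ(x) - ℓ(u⁻¹ x)` of a length function. -/
def lengthIncrement (S : Set G) (u x : G) : ℂ :=
  (((wordLength S x : ℤ) - wordLength S (u⁻¹ * x) : ℤ) : ℂ)

theorem norm_lengthIncrement_le {S : Set G} (hS : Subgroup.closure S = ⊤) (u x : G) :
    ‖lengthIncrement S u x‖ ≤ wordLength S u := by
  rw [lengthIncrement, Complex.norm_intCast]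
  exact_mod_cast abs_wordLength_sub_le hS u x

variable {S : Set G} (hS : Subgroup.closure S = ⊤)

/-- The bounded extension of the commutator `[M_ℓ, f]`: the sum of the `f(u) M_{ω_u} λ_u`,
where `ω_u` is the bounded function `x ↦ ℓ(x) - ℓ(u⁻¹ x)`. -/
def commutatorOp (g : MonoidAlgebra ℂ G) : EllTwo G →L[ℂ] EllTwo G :=
  Finsupp.linearCombination ℂ (fun u => boundedMul (lengthIncrement S u) (wordLength S u)
    (norm_lengthIncrement_le hS u) ∘L leftRegular G u) g.coeff

theorem commutatorOp_apply (g : MonoidAlgebra ℂ G) (ξ : EllTwo G) (x : G) :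
    commutatorOp hS g ξ x =
      ∑ u ∈ g.coeff.support, g.coeff u * (lengthIncrement S u x * ξ (u⁻¹ * x)) := by
  rw [commutatorOp, Finsupp.linearCombination_apply, Finsupp.sum, sum_apply, EllTwo.sum_apply]
  rfl

theorem commutatorOp_add (g h : MonoidAlgebra ℂ G) :
    commutatorOp hS (g + h) = commutatorOp hS g + commutatorOp hS h := by
  simp only [commutatorOp, MonoidAlgebra.coeff_add, map_add]

theorem commutatorOp_smul (c : ℂ) (g : MonoidAlgebra ℂ G) :
    commutatorOp hS (c • g) = c • commutatorOp hS g := by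
  simp only [commutatorOp, MonoidAlgebra.coeff_smul, map_smul]

/-- The Leibniz-type identity `ℓ · (f * ξ) = f * (ℓ ξ) + [M_ℓ, f] ξ`, pointwise. -/
theorem wordLength_mul_convolutionRep_apply (g : MonoidAlgebra ℂ G) (ξ : EllTwo G) (x : G) :
    (wordLength S x : ℂ) * convolutionRep G g ξ x =
      ∑ u ∈ g.coeff.support, g.coeff u * ((wordLength S (u⁻¹ * x) : ℂ) * ξ (u⁻¹ * x)) +
        commutatorOp hS g ξ x := by
  rw [convolutionRep_apply, commutatorOp_apply, Finset.mul_sum, ← Finset.sum_add_distrib]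
  refine Finset.sum_congr rfl fun u _ => ?_
  simp only [lengthIncrement]
  push_cast
  ring

include hS in
theorem convolutionRep_mem_domain (g : MonoidAlgebra ℂ G) {ξ : EllTwo G}
    (hξ : ξ ∈ (wordDirac S).domain) : convolutionRep G g ξ ∈ (wordDirac S).domain := by
  change Memℓp (fun x => (wordLength S x : ℂ) * convolutionRep G g ξ x) 2
  refine (congrArg (fun f => Memℓp f 2) ?_).mp
    (lp.memℓp (convolutionRep G g (wordDirac S ⟨ξ, hξ⟩) + commutatorOp hS g ξ))
  funext x
  rw [wordLength_mul_convolutionRep_apply hS, lp.coeFn_add, Pi.add_apply, convolutionRep_apply]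
  rfl

include hS in
theorem diracCommutator_domain (g : MonoidAlgebra ℂ G) :
    (diracCommutator (wordDirac S) (convolutionRep G g)).domain = (wordDirac S).domain :=
  le_antisymm inf_le_left (le_inf le_rfl fun _ hξ => convolutionRep_mem_domain hS g hξ)

theorem diracCommutator_apply (g : MonoidAlgebra ℂ G)
    (ξ : (diracCommutator (wordDirac S) (convolutionRep G g)).domain) :
    diracCommutator (wordDirac S) (convolutionRep G g) ξ = commutatorOp hS g ξ := by
  ext x
  have h : diracCommutator (wordDirac S) (convolutionRep G g) ξ x =
      (wordLength S x : ℂ) * convolutionRep G g ξ x -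
        convolutionRep G g (wordDirac S ⟨ξ, ξ.2.1⟩) x := rfl
  rw [h, wordLength_mul_convolutionRep_apply hS, convolutionRep_apply, sub_eq_iff_eq_add']
  rfl

theorem wordSeminorm_eq (g : MonoidAlgebra ℂ G) (a : convolutionOperators G)
    (ha : a.1 = convolutionRep G g) : wordSeminorm S a = ‖commutatorOp hS g‖ₑ := by
  rw [wordSeminorm, diracSeminorm, ha]
  set T := diracCommutator (wordDirac S) (convolutionRep G g)
  have hle : pmapENorm T ≤ ‖commutatorOp hS g‖ₑ := by
    refine iSup₂_le fun ξ hξ => ?_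
    rw [diracCommutator_apply hS]
    refine (ContinuousLinearMap.le_opENorm _ _).trans ?_
    refine (mul_le_mul_right (b := ‖(ξ : EllTwo G)‖ₑ) (c := 1) ?_ _).trans (mul_one _).le
    rw [← ofReal_norm]
    exact (ENNReal.ofReal_le_ofReal hξ).trans (by simp)
  refine le_antisymm hle ?_
  have hfin : pmapENorm T ≠ ∞ := (hle.trans_lt enorm_lt_top).ne
  have hdense : Dense (T.domain : Set (EllTwo G)) := by
    rw [diracCommutator_domain hS]
    exact dense_mulOperator_domain _
  have hclosed : IsClosed {ξ : EllTwo G | ‖commutatorOp hS g ξ‖ ≤ (pmapENorm T).toReal * ‖ξ‖} :=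
    isClosed_le (by fun_prop) (by fun_prop)
  have hall : ∀ ξ, ‖commutatorOp hS g ξ‖ ≤ (pmapENorm T).toReal * ‖ξ‖ := fun ξ =>
    hclosed.closure_subset_iff.mpr (fun ζ hζ => by
      have h := enorm_apply_le_pmapENorm T ⟨ζ, hζ⟩
      rw [diracCommutator_apply hS] at h
      have h' := ENNReal.toReal_mono (ENNReal.mul_ne_top hfin enorm_ne_top) h
      simpa using h') (hdense ξ)
  have h := ContinuousLinearMap.opNorm_le_bound _ ENNReal.toReal_nonneg hall
  rw [← ofReal_norm, ← ENNReal.ofReal_toReal hfin]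
  exact ENNReal.ofReal_le_ofReal h

/-- Applying `[M_ℓ, f]` to `δ_1` gives `ℓ f`. -/
theorem commutatorOp_single_one [DecidableEq G] (g : MonoidAlgebra ℂ G) (x : G) :
    commutatorOp hS g (lp.single 2 1 1) x = wordLength S x * g.coeff x := by
  rw [commutatorOp_apply, Finset.sum_eq_single x]
  · simp [lengthIncrement, mul_comm]
  · intro u _ hu
    have : u⁻¹ * x ≠ 1 := fun h => hu (by rwa [inv_mul_eq_one] at h)
    simp [this]
  · intro hx
    simp [Finsupp.notMem_support_iff.mp hx]

theorem l2Norm_wordLength_mul_le (g : MonoidAlgebra ℂ G) :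
    l2Norm (fun x => (wordLength S x : ℝ≥0∞) * ‖g.coeff x‖ₑ) ≤ ‖commutatorOp hS g‖ₑ := by
  classical
  have h := ContinuousLinearMap.le_opENorm (commutatorOp hS g) (lp.single 2 1 1)
  have h1 : ‖(lp.single 2 1 1 : EllTwo G)‖ₑ = 1 := by
    rw [← ofReal_norm, lp.norm_single (by norm_num)]
    simp
  rw [h1, mul_one, enorm_eq_l2Norm] at h
  simp only [commutatorOp_single_one hS, enorm_mul] at h
  refine le_trans (le_of_eq ?_) h
  congr 1
  funext x
  congr 1
  rw [← ofReal_norm]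
  simp

/-- The main estimate. The part of `f` far from the diagonal is obtained from the commutator
`[M_ℓ, f]` by the Schur multiplier `1 / j` for `|j| > N`, which has norm `≤ √(2/N)`; the
remaining diagonals are controlled by the Haagerup inequality. -/
theorem enorm_convolutionRep_le {c : ℝ≥0∞}
    (hH : ∀ (f ξ η : G → ℝ≥0∞) (k n m : ℤ),
      ∑' x, ∑' y, shell (wordLength S) k f x * shell (wordLength S) n ξ y *
        shell (wordLength S) m η (x * y) ≤
      c * (l2Norm (shell (wordLength S) k f) * l2Norm (shell (wordLength S) n ξ) *
        l2Norm (shell (wordLength S) m η)))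
    {N : ℕ} (hN : N ≠ 0) (g : MonoidAlgebra ℂ G) :
    ‖convolutionRep G g‖ₑ ≤ ENNReal.ofReal √(2 / N) * ‖commutatorOp hS g‖ₑ +
      (2 * N + 1) * c * ∑' k, l2Norm (shell (wordLength S) k fun x => ‖g.coeff x‖ₑ) := by
  set ℓ := wordLength S
  set B := commutatorOp hS g
  -- `f` shifts lengths by at most `R`, so only finitely many values of the multiplier matter
  set R : ℕ := g.coeff.support.sup ℓ with hR
  obtain ⟨ι, _, φ, e, he1, hesub, hφ, hφsum⟩ :=
    exists_character_expansion (fun j => if |j| ≤ (N : ℤ) then 0 else (j : ℂ)⁻¹) R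
  set U : ι → EllTwo G →L[ℂ] EllTwo G := fun r =>
    boundedMul (fun x => e r (ℓ x)) 1 (fun x => (he1 r _).le)
  set V : ι → EllTwo G →L[ℂ] EllTwo G := fun r =>
    boundedMul (fun x => star (e r (ℓ x))) 1 (fun x => by rw [norm_star]; exact (he1 r _).le)
  -- the Schur multiplier as a combination of conjugations by diagonal unitaries
  set E : EllTwo G →L[ℂ] EllTwo G := ∑ r, φ r • (U r ∘L B ∘L V r)
  have hE : ‖E‖ₑ ≤ ENNReal.ofReal √(2 / N) * ‖B‖ₑ := by
    have h1 : ‖E‖ₑ ≤ ∑ r, ‖φ r‖ₑ * ‖B‖ₑ := by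
      refine (enorm_sum_le (ε := EllTwo G →L[ℂ] EllTwo G) _ _).trans
        (Finset.sum_le_sum fun r _ => ?_)
      rw [enorm_smul]
      gcongr
      calc ‖U r ∘L B ∘L V r‖ₑ ≤ ‖U r‖ₑ * (‖B‖ₑ * ‖V r‖ₑ) :=
            (ContinuousLinearMap.opENorm_comp_le _ _).trans
              (by gcongr; exact ContinuousLinearMap.opENorm_comp_le _ _)
        _ ≤ 1 * (‖B‖ₑ * 1) := by
            gcongr <;> exact enorm_boundedMul_le_one _ _
        _ = ‖B‖ₑ := by simp
    refine h1.trans ?_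
    rw [← Finset.sum_mul]
    gcongr
    have h2 : ∑ r, ‖φ r‖ₑ = ENNReal.ofReal (∑ r, ‖φ r‖) := by
      rw [ENNReal.ofReal_sum_of_nonneg fun _ _ => norm_nonneg _]
      exact Finset.sum_congr rfl fun r _ => (ofReal_norm _).symm
    rw [h2]
    exact ENNReal.ofReal_le_ofReal
      (hφsum.trans (Real.sqrt_le_sqrt (sum_inv_sq_outside_le hN R)))
  have hEapply : ∀ ξ x, E ξ x = ∑ u ∈ g.coeff.support,
      if |(ℓ x : ℤ) - ℓ (u⁻¹ * x)| ≤ N then 0 else g.coeff u * ξ (u⁻¹ * x) := by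
    intro ξ x
    have h1 : ∀ r, (φ r • (U r ∘L B ∘L V r)) ξ x = φ r * (e r (ℓ x) * B (V r ξ) x) :=
      fun r => rfl
    rw [sum_apply, EllTwo.sum_apply]
    simp only [h1, B, commutatorOp_apply, V, boundedMul_apply, Finset.mul_sum]
    rw [Finset.sum_comm]
    refine Finset.sum_congr rfl fun u hu => ?_
    have h2 : ∀ r, φ r * (e r (ℓ x) * (g.coeff u * (lengthIncrement S u x *
        (star (e r (ℓ (u⁻¹ * x))) * ξ (u⁻¹ * x))))) =
        φ r * e r ((ℓ x : ℤ) - ℓ (u⁻¹ * x)) *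
          (lengthIncrement S u x * (g.coeff u * ξ (u⁻¹ * x))) := by
      intro r
      rw [hesub]
      ring
    simp only [h2]
    rw [← Finset.sum_mul, hφ _ ((abs_wordLength_sub_le hS u x).trans
      (by exact_mod_cast Finset.le_sup (f := ℓ) hu))]
    split_ifs with h3
    · simp
    · have h4 : lengthIncrement S u x ≠ 0 := by
        rw [lengthIncrement, Int.cast_ne_zero]
        intro h0
        exact h3 (by rw [h0]; simp)
      exact inv_mul_cancel_left₀ h4 _
  have hrest : ‖convolutionRep G g - E‖ₑ ≤
      (2 * N + 1) * c * ∑' k, l2Norm (shell ℓ k fun x => ‖g.coeff x‖ₑ) := by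
    refine ContinuousLinearMap.opENorm_le_bound _ fun ξ => ?_
    set ζ := (convolutionRep G g - E) ξ
    have hζ : ∀ x, ‖ζ x‖ₑ ≤ ∑' u,
        if |(ℓ x : ℤ) - ℓ (u⁻¹ * x)| ≤ N then ‖g.coeff u‖ₑ * ‖ξ (u⁻¹ * x)‖ₑ else 0 := by
      intro x
      have h1 : ζ x = ∑ u ∈ g.coeff.support,
          if |(ℓ x : ℤ) - ℓ (u⁻¹ * x)| ≤ N then g.coeff u * ξ (u⁻¹ * x) else 0 := by
        change convolutionRep G g ξ x - E ξ x = _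
        rw [hEapply, convolutionRep_apply, ← Finset.sum_sub_distrib]
        refine Finset.sum_congr rfl fun u _ => ?_
        split_ifs <;> simp
      rw [h1]
      refine (enorm_sum_le _ _).trans (le_trans (Finset.sum_le_sum fun u _ => ?_)
        (ENNReal.sum_le_tsum g.coeff.support))
      split_ifs
      · rw [enorm_mul]
      · simp
    have hsq : ‖ζ‖ₑ ^ 2 ≤ (2 * N + 1) * c * (∑' k, l2Norm (shell ℓ k fun x => ‖g.coeff x‖ₑ)) *
        (‖ξ‖ₑ * ‖ζ‖ₑ) := by
      rw [enorm_eq_l2Norm ζ, l2Norm_sq, enorm_eq_l2Norm ξ]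
      refine le_trans ?_ (band_le hH N (fun x => ‖g.coeff x‖ₑ) (fun x => ‖ξ x‖ₑ)
        (fun x => ‖ζ x‖ₑ))
      calc ∑' x, ‖ζ x‖ₑ ^ 2 ≤ ∑' x, ∑' u, (if |(ℓ x : ℤ) - ℓ (u⁻¹ * x)| ≤ N then
            ‖g.coeff u‖ₑ * ‖ξ (u⁻¹ * x)‖ₑ else 0) * ‖ζ x‖ₑ := by
            refine ENNReal.tsum_le_tsum fun x => ?_
            rw [pow_two, ENNReal.tsum_mul_right]
            gcongr
            exact hζ x
        _ = ∑' u, ∑' x, (if |(ℓ x : ℤ) - ℓ (u⁻¹ * x)| ≤ N then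
            ‖g.coeff u‖ₑ * ‖ξ (u⁻¹ * x)‖ₑ else 0) * ‖ζ x‖ₑ := ENNReal.tsum_comm
        _ ≤ _ := by
            refine ENNReal.tsum_le_tsum fun u => ?_
            rw [← (Equiv.mulLeft u).tsum_eq]
            refine ENNReal.tsum_le_tsum fun y => ?_
            simp only [Equiv.coe_mulLeft, inv_mul_cancel_left, ite_mul, zero_mul]
            exact le_rfl
    by_cases h0 : ‖ζ‖ₑ = 0
    · rw [h0]; exact zero_le
    rw [pow_two, ← mul_assoc] at hsq
    exact (ENNReal.mul_le_mul_iff_left h0 enorm_ne_top).mp hsq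
  calc ‖convolutionRep G g‖ₑ = ‖E + (convolutionRep G g - E)‖ₑ := by rw [add_sub_cancel]
    _ ≤ ‖E‖ₑ + ‖convolutionRep G g - E‖ₑ := enorm_add_le (E := EllTwo G →L[ℂ] EllTwo G) _ _
    _ ≤ _ := add_le_add hE hrest

end Commutator

/-! ### Total boundedness of the unit ball of the seminorm -/

section Compactness

open Filter

/-- The `ℓ²`-norm is at most the `ℓ¹`-norm. -/
theorem l2Norm_le_tsum {α : Type*} (f : α → ℝ≥0∞) : l2Norm f ≤ ∑' x, f x := by
  refine ENNReal.le_of_sq_le_sq ?_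
  rw [l2Norm_sq, pow_two, ← ENNReal.tsum_mul_left]
  refine ENNReal.tsum_le_tsum fun x => ?_
  rw [pow_two]
  gcongr
  exact ENNReal.le_tsum x

theorem tsum_inv_int_sq_ne_top : ∑' k : ℤ, ENNReal.ofReal |(k : ℝ)|⁻¹ ^ 2 ≠ ∞ := by
  have h1 : ∀ k : ℤ, ENNReal.ofReal |(k : ℝ)|⁻¹ ^ 2 = ENNReal.ofReal (1 / (k : ℝ) ^ 2) := by
    intro k
    rw [← ENNReal.ofReal_pow (by positivity), inv_pow, sq_abs, one_div]
  simp only [h1]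
  rw [← ENNReal.ofReal_tsum_of_nonneg (fun _ => by positivity)
    (Real.summable_one_div_int_pow.mpr one_lt_two)]
  exact ENNReal.ofReal_ne_top

/-- Up to a small multiple of the weighted norm `‖ℓ f‖₂`, the sum of the norms of the shells of
`f` is controlled by finitely many values of `f`. -/
theorem exists_tsum_shell_le {G : Type*} {ℓ : G → ℕ} (hℓ : ∀ n, {x | ℓ x ≤ n}.Finite)
    {C ε : ℝ≥0∞} (hC : C ≠ ∞) (hε : ε ≠ 0) :
    ∃ F : Finset G, ∀ f : G → ℝ≥0∞,
      C * ∑' k, l2Norm (shell ℓ k f) ≤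
        ε * l2Norm (fun x => (ℓ x : ℝ≥0∞) * f x) + C * ∑ x ∈ F, f x := by
  set w : ℤ → ℝ≥0∞ := fun k => ENNReal.ofReal |(k : ℝ)|⁻¹
  have htend : Tendsto (fun s : Finset ℤ => C * (∑' k : {k // k ∉ s}, w k ^ 2) ^ (1 / 2 : ℝ))
      atTop (𝓝 0) := by
    have h1 := ((ENNReal.continuous_rpow_const (y := 1 / 2)).tendsto 0).comp
      (ENNReal.tendsto_tsum_compl_atTop_zero tsum_inv_int_sq_ne_top)
    have h2 := ENNReal.Tendsto.const_mul h1 (Or.inr hC)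
    simpa using h2
  obtain ⟨s, hs, hs0⟩ := ((htend.eventually (gt_mem_nhds (pos_iff_ne_zero.mpr hε))).and
    (eventually_ge_atTop {0})).exists
  have h0s : (0 : ℤ) ∈ s := hs0 (Finset.mem_singleton_self 0)
  refine ⟨(hℓ (s.sup Int.natAbs)).toFinset, fun f => ?_⟩
  set F := (hℓ (s.sup Int.natAbs)).toFinset
  have hnear : ∑ k ∈ s, l2Norm (shell ℓ k f) ≤ ∑ x ∈ F, f x := by
    calc ∑ k ∈ s, l2Norm (shell ℓ k f) ≤ ∑ k ∈ s, ∑ x ∈ F, shell ℓ k f x := by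
          refine Finset.sum_le_sum fun k hk => (l2Norm_le_tsum _).trans (le_of_eq ?_)
          refine tsum_eq_sum fun x hx => ?_
          rw [shell, if_neg]
          rintro rfl
          have := Finset.le_sup (f := Int.natAbs) hk
          exact hx (by simpa [F] using this)
      _ = ∑ x ∈ F, ∑ k ∈ s, shell ℓ k f x := Finset.sum_comm
      _ ≤ ∑ x ∈ F, f x := by
          refine Finset.sum_le_sum fun x _ => ?_
          exact (ENNReal.sum_le_tsum s).trans (tsum_shell ℓ f x).le
  have hweight : ∀ k : ℤ, k ∉ s → l2Norm (shell ℓ k f) ≤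
      w k * l2Norm (shell ℓ k fun x => (ℓ x : ℝ≥0∞) * f x) := by
    intro k hk
    have hk0 : k ≠ 0 := fun h => hk (h ▸ h0s)
    have hk0' : (0 : ℝ) < |(k : ℝ)| := by positivity
    refine ENNReal.le_of_sq_le_sq ?_
    rw [mul_pow, l2Norm_sq, l2Norm_sq, ← ENNReal.tsum_mul_left]
    refine ENNReal.tsum_le_tsum fun x => ?_
    rw [← mul_pow]
    refine pow_le_pow_left' ?_ 2
    simp only [shell]
    split_ifs with h
    · have h1 : (ℓ x : ℝ≥0∞) = ENNReal.ofReal |(k : ℝ)| := by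
        rw [← h, Int.cast_natCast, Nat.abs_cast, ENNReal.ofReal_natCast]
      rw [h1, ← mul_assoc, ← ENNReal.ofReal_mul (by positivity), inv_mul_cancel₀ hk0'.ne']
      simp
    · simp
  have hfar : ∑' k : {k // k ∉ s}, l2Norm (shell ℓ k f) ≤
      (∑' k : {k // k ∉ s}, w k ^ 2) ^ (1 / 2 : ℝ) * l2Norm (fun x => (ℓ x : ℝ≥0∞) * f x) := by
    refine (ENNReal.tsum_le_tsum fun k : {k // k ∉ s} => hweight k.1 k.2).trans
      ((tsum_mul_le_l2Norm _ _).trans ?_)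
    refine mul_le_mul' le_rfl (ENNReal.le_of_sq_le_sq ?_)
    rw [l2Norm_sq, ← tsum_l2Norm_shell_sq ℓ]
    exact ENNReal.tsum_comp_le_tsum_of_injective Subtype.val_injective _
  rw [← ENNReal.sum_add_tsum_compl s, mul_add, add_comm]
  refine add_le_add ?_ (by gcongr)
  refine (mul_le_mul' le_rfl hfar).trans ?_
  rw [← mul_assoc]
  gcongr

variable {G : Type*} [Group G] {S : Set G}

theorem convolutionRep_single_one (z : ℂ) :
    convolutionRep G (MonoidAlgebra.single 1 z) = algebraMap ℂ _ z := by
  rw [convolutionRep, MonoidAlgebra.lift_single, map_one, Algebra.algebraMap_eq_smul_one]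

theorem commutatorOp_scalar (hS : Subgroup.closure S = ⊤) (z : ℂ) :
    commutatorOp hS (MonoidAlgebra.single 1 z) = 0 := by
  ext ξ x
  rw [commutatorOp_apply]
  refine Finset.sum_eq_zero fun u hu => ?_
  have hu1 : u = 1 := by
    by_contra h
    simp [MonoidAlgebra.coeff_single, Ne.symm h] at hu
  simp [hu1, lengthIncrement]

/-- The unit ball of the seminorm `‖[M_ℓ, ·]‖` is totally bounded for the operator norm modulo the
scalars. -/
theorem exists_finite_net_commutatorOp (hG : IsWordHyperbolic G) (hfin : S.Finite)
    (hS : Subgroup.closure S = ⊤) {ε : ℝ} (hε : 0 < ε) :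
    ∃ t : Set (MonoidAlgebra ℂ G), t.Finite ∧ ∀ g, ‖commutatorOp hS g‖ₑ ≤ 1 →
      ∃ h ∈ t, ∃ z : ℂ, ‖convolutionRep G g - convolutionRep G h - algebraMap ℂ _ z‖ ≤ ε := by
  classical
  obtain ⟨C₀, N₀, hN₀, hfac⟩ := exists_boundedly_many_factorizations hG hfin hS
  set c : ℝ≥0∞ := ((C₀ : ℝ≥0∞) ^ (1 / 2 : ℝ)) ^ 3
  have hc : c ≠ ∞ := by
    exact ENNReal.pow_ne_top (ENNReal.rpow_ne_top_of_nonneg (by norm_num) (ENNReal.natCast_ne_top _))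
  have hH := haagerup_of_factorizations hN₀ hfac
  -- the part far from the diagonal is at most `ε / 4` for commutators of norm at most `2`
  obtain ⟨N, hN, hNε⟩ : ∃ N : ℕ, N ≠ 0 ∧ √(2 / N) ≤ ε / 8 := by
    have h1 : Tendsto (fun N : ℕ => √(2 / (N : ℝ))) atTop (𝓝 0) := by
      have h := (Real.continuous_sqrt.tendsto 0).comp (tendsto_const_div_atTop_nhds_zero_nat 2)
      simpa only [Real.sqrt_zero, Function.comp_def] using h
    obtain ⟨N, h2, h3⟩ := ((h1.eventually (gt_mem_nhds (show 0 < ε / 8 by positivity))).and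
      (eventually_ge_atTop 1)).exists
    exact ⟨N, by omega, h2.le⟩
  set C : ℝ≥0∞ := (2 * N + 1) * c
  have hC : C ≠ ∞ := ENNReal.mul_ne_top (by finiteness) hc
  obtain ⟨F, hF⟩ := exists_tsum_shell_le (finite_wordLength_le hfin hS) hC
    (ε := ENNReal.ofReal (ε / 8)) (by simpa using hε)
  have hkey : ∀ g, ‖commutatorOp hS g‖ₑ ≤ 2 →
      ‖convolutionRep G g‖ ≤ ε / 2 + C.toReal * ∑ x ∈ F, ‖g.coeff x‖ := by
    intro g hg
    have h1 := enorm_convolutionRep_le hS hH hN g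
    have h2 := hF fun x => ‖g.coeff x‖ₑ
    have h3 : ‖convolutionRep G g‖ₑ ≤ ENNReal.ofReal (ε / 8) * 2 +
        (ENNReal.ofReal (ε / 8) * 2 + C * ∑ x ∈ F, ‖g.coeff x‖ₑ) := by
      refine h1.trans (add_le_add ?_ (h2.trans (add_le_add ?_ le_rfl)))
      · exact mul_le_mul' (ENNReal.ofReal_le_ofReal hNε) hg
      · exact mul_le_mul' le_rfl ((l2Norm_wordLength_mul_le hS g).trans hg)
    have h4 : ENNReal.ofReal (ε / 8) * 2 +
        (ENNReal.ofReal (ε / 8) * 2 + C * ∑ x ∈ F, ‖g.coeff x‖ₑ) =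
        ENNReal.ofReal (ε / 2 + C.toReal * ∑ x ∈ F, ‖g.coeff x‖) := by
      rw [ENNReal.ofReal_add (by positivity) (by positivity), ENNReal.ofReal_mul (by positivity),
        ENNReal.ofReal_toReal hC, ENNReal.ofReal_sum_of_nonneg fun _ _ => norm_nonneg _,
        ← add_assoc]
      simp only [ofReal_norm]
      congr 1
      rw [show (2 : ℝ≥0∞) = ENNReal.ofReal 2 by simp, ← ENNReal.ofReal_mul (by positivity),
        ← ENNReal.ofReal_add (by positivity) (by positivity)]
      congr 1
      ring
    rw [h4, ← ofReal_norm] at h3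
    exact (ENNReal.ofReal_le_ofReal_iff (by positivity)).mp h3
  -- restriction to the finite set `F` maps the ball to a bounded subset of a finite-dimensional
  -- space
  set r : MonoidAlgebra ℂ G → F → ℂ := fun g x => g.coeff x
  set X : Set (MonoidAlgebra ℂ G) := {g | ‖commutatorOp hS g‖ₑ ≤ 1 ∧ g.coeff 1 = 0}
  have hX : r '' X ⊆ Metric.closedBall 0 1 := by
    rintro _ ⟨g, ⟨hg, hg1⟩, rfl⟩
    rw [mem_closedBall_zero_iff, pi_norm_le_iff_of_nonneg zero_le_one]
    rintro ⟨x, hx⟩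
    change ‖g.coeff x‖ ≤ 1
    by_cases hx1 : x = 1
    · rw [hx1, hg1]; simp
    have hl : 1 ≤ wordLength S x := Nat.one_le_iff_ne_zero.mpr
      fun h => hx1 ((wordLength_eq_zero_iff hS).mp h)
    have h1 : ‖g.coeff x‖ₑ ^ 2 ≤ 1 ^ 2 := by
      calc ‖g.coeff x‖ₑ ^ 2 ≤ ((wordLength S x : ℝ≥0∞) * ‖g.coeff x‖ₑ) ^ 2 := by
            refine pow_le_pow_left' (le_mul_of_one_le_left' ?_) 2
            exact_mod_cast hl
        _ ≤ l2Norm (fun x => (wordLength S x : ℝ≥0∞) * ‖g.coeff x‖ₑ) ^ 2 := by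
            rw [l2Norm_sq]
            exact ENNReal.le_tsum (f := fun x => ((wordLength S x : ℝ≥0∞) * ‖g.coeff x‖ₑ) ^ 2) x
        _ ≤ 1 ^ 2 := pow_le_pow_left' ((l2Norm_wordLength_mul_le hS g).trans hg) 2
    have h2 := ENNReal.le_of_sq_le_sq h1
    rw [← ofReal_norm, ENNReal.ofReal_le_one] at h2
    exact h2
  have htb : TotallyBounded (r '' X) :=
    (isCompact_closedBall (0 : F → ℂ) 1).totallyBounded.subset hX
  set η : ℝ := ε / 2 / (C.toReal * F.card + 1)
  have hη : 0 < η := by positivity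
  obtain ⟨t, htX, htfin, hcov⟩ := Set.exists_subset_image_finite_and.mp
    (Metric.finite_approx_of_totallyBounded htb η hη)
  refine ⟨t, htfin, fun g hg => ?_⟩
  set z := g.coeff 1
  set g₀ := g - MonoidAlgebra.single 1 z
  have hg₀ : commutatorOp hS g₀ = commutatorOp hS g := by
    have h := commutatorOp_add hS g₀ (MonoidAlgebra.single 1 z)
    rw [sub_add_cancel, commutatorOp_scalar, add_zero] at h
    exact h.symm
  have hg₀X : g₀ ∈ X := ⟨hg₀ ▸ hg, by simp [g₀, z, MonoidAlgebra.coeff_sub, MonoidAlgebra.coeff_single]⟩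
  obtain ⟨_, ⟨h, hht, rfl⟩, hdist⟩ := Set.mem_iUnion₂.mp (hcov (Set.mem_image_of_mem r hg₀X))
  refine ⟨h, hht, z, ?_⟩
  have hdiff : ‖commutatorOp hS (g₀ - h)‖ₑ ≤ 2 := by
    have h1 : commutatorOp hS (g₀ - h) = commutatorOp hS g₀ - commutatorOp hS h := by
      rw [eq_sub_iff_add_eq, ← commutatorOp_add, sub_add_cancel]
    rw [h1]
    refine (enorm_sub_le (E := EllTwo G →L[ℂ] EllTwo G)).trans ?_
    exact (add_le_add hg₀X.1 (htX hht).1).trans one_add_one_eq_two.le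
  have heq : convolutionRep G g - convolutionRep G h - algebraMap ℂ _ z =
      convolutionRep G (g₀ - h) := by
    rw [← convolutionRep_single_one, map_sub, map_sub]
    abel
  rw [heq]
  refine (hkey _ hdiff).trans ?_
  have hsum : ∑ x ∈ F, ‖(g₀ - h).coeff x‖ ≤ F.card * η := by
    rw [← nsmul_eq_mul, ← Finset.sum_const]
    refine Finset.sum_le_sum fun x hx => ?_
    rw [Metric.mem_ball, dist_eq_norm] at hdist
    exact (norm_le_pi_norm (r g₀ - r h) ⟨x, hx⟩).trans hdist.le
  have hη' : C.toReal * (F.card * η) ≤ ε / 2 := by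
    have h0 : 0 ≤ C.toReal := ENNReal.toReal_nonneg
    have : (C.toReal * F.card + 1) * η = ε / 2 := mul_div_cancel₀ _ (by positivity)
    nlinarith
  have := mul_le_mul_of_nonneg_left hsum (ENNReal.toReal_nonneg (a := C))
  linarith

end Compactness

/-! ### States and the metric of a seminorm -/

section StateSpaces

open Filter

/-- States are bounded uniformly. (The bound `‖φ b‖ ≤ ‖b‖` holds, but any constant will do.) -/
theorem norm_apply_le_of_mem_stateSpace {B : Type*} [CStarAlgebra B] {φ : WeakDual ℂ B}
    (hφ : φ ∈ stateSpace B) (b : B) : ‖φ b‖ ≤ 4 * ‖b‖ := by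
  let : PartialOrder B := CStarAlgebra.spectralOrder B
  have : StarOrderedRing B := CStarAlgebra.spectralOrderedRing B
  have hpos : ∀ x : B, 0 ≤ x → 0 ≤ φ x := by
    intro x hx
    obtain ⟨y, rfl⟩ := CStarAlgebra.nonneg_iff_eq_star_mul_self.mp hx
    exact hφ.2 y
  have hbound : ∀ x : B, 0 ≤ x → ‖φ x‖ ≤ ‖x‖ := by
    intro x hx
    have h1 := hpos x hx
    have h2 := hpos _ (sub_nonneg.mpr (IsSelfAdjoint.le_algebraMap_norm_self
      (IsSelfAdjoint.of_nonneg hx)))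
    have h3 : φ (algebraMap ℝ B ‖x‖) = ‖x‖ := by
      rw [IsScalarTower.algebraMap_apply ℝ ℂ B, Algebra.algebraMap_eq_smul_one, map_smul, hφ.1]
      simp
    rw [map_sub, h3] at h2
    have h4 : (‖φ x‖ : ℂ) = φ x := by
      rw [← Complex.eq_coe_norm_of_nonneg h1]
    rw [← h4] at h2
    rw [sub_nonneg] at h2
    exact_mod_cast h2
  obtain ⟨x, hx0, hxn, hx⟩ := CStarAlgebra.exists_sum_four_nonneg b
  have h : φ b = ∑ i : Fin 4, Complex.I ^ (i : ℕ) * φ (x i) := by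
    conv_lhs => rw [hx]
    simp only [map_sum, map_smul, smul_eq_mul]
  rw [h]
  refine (norm_sum_le _ _).trans ?_
  calc ∑ i : Fin 4, ‖Complex.I ^ (i : ℕ) * φ (x i)‖ ≤ ∑ _i : Fin 4, ‖b‖ := by
        refine Finset.sum_le_sum fun i _ => ?_
        rw [norm_mul, norm_pow, Complex.norm_I, one_pow, one_mul]
        exact (hbound _ (hx0 i)).trans (hxn i)
    _ = 4 * ‖b‖ := by simp

variable {H : Type*} [NormedAddCommGroup H] [InnerProductSpace ℂ H] [CompleteSpace H]
  {A : StarSubalgebra ℂ (H →L[ℂ] H)} {L : A → ℝ≥0∞}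

theorem States.norm_apply_le (μ : States A) (b : A.topologicalClosure) : ‖μ.1 b‖ ≤ 4 * ‖b‖ := by
  have : IsClosed (A.topologicalClosure : Set (H →L[ℂ] H)) := A.isClosed_topologicalClosure
  exact norm_apply_le_of_mem_stateSpace (B := A.topologicalClosure) μ.2 b

theorem States.norm_sub_apply_le (μ ν : States A) (b : A.topologicalClosure) :
    ‖μ.1 b - ν.1 b‖ ≤ 8 * ‖b‖ := by
  have := norm_sub_le (μ.1 b) (ν.1 b)
  linarith [μ.norm_apply_le b, ν.norm_apply_le b]

/-- The inclusion of a pre-`C*`-algebra into its closure. -/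
abbrev toClosure (a : A) : A.topologicalClosure :=
  StarSubalgebra.inclusion A.le_topologicalClosure a

/-- States that nearly agree at `b` nearly agree at elements that are close to `b` modulo
scalars. -/
theorem States.norm_sub_le_of_near (μ ν : States A) (a b : A) (z : ℂ) {ε : ℝ}
    (h : ‖(a : H →L[ℂ] H) - b - algebraMap ℂ _ z‖ ≤ ε) :
    ‖μ.1 (toClosure a) - ν.1 (toClosure a)‖ ≤
      ‖μ.1 (toClosure b) - ν.1 (toClosure b)‖ + 8 * ε := by
  set d : A.topologicalClosure := toClosure a - toClosure b - z • (1 : A.topologicalClosure) with hd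
  have hdn : ‖d‖ ≤ ε := by
    refine le_trans (le_of_eq ?_) h
    rw [Algebra.algebraMap_eq_smul_one]
    rfl
  have hab : toClosure a = toClosure b + z • (1 : A.topologicalClosure) + d := by
    rw [hd]; abel
  have hμ : ∀ κ : States A, κ.1 (toClosure a) = κ.1 (toClosure b) + z + κ.1 d := by
    intro κ
    rw [hab, map_add, map_add, map_smul, κ.2.1]
    simp
  rw [hμ μ, hμ ν]
  have h1 := norm_add_le (μ.1 (toClosure b) - ν.1 (toClosure b)) (μ.1 d - ν.1 d)
  have h2 := μ.norm_sub_apply_le ν d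
  rw [show μ.1 (toClosure b) + z + μ.1 d - (ν.1 (toClosure b) + z + ν.1 d) =
    μ.1 (toClosure b) - ν.1 (toClosure b) + (μ.1 d - ν.1 d) by ring]
  linarith

/-- The distance `ρ_L` controls the values of states at elements of `A`. -/
theorem enorm_sub_le_mul_stateDist (hfinite : ∀ a, L a < ∞)
    (hsmul : ∀ (c : ℂ) (a), L (c • a) = ‖c‖ₑ * L a) (μ ν : States A) (a : A) :
    ‖μ.1 (toClosure a) - ν.1 (toClosure a)‖ₑ ≤ (L a + 1) * stateDist A L μ ν := by
  have hfin : L a + 1 ≠ ∞ := (ENNReal.add_lt_top.mpr ⟨hfinite a, ENNReal.one_lt_top⟩).ne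
  set K : ℝ := (L a + 1).toReal
  have hK : 0 < K := ENNReal.toReal_pos (by simp) hfin
  have hKe : ENNReal.ofReal K = L a + 1 := ENNReal.ofReal_toReal hfin
  have hKn : ‖(K : ℂ)‖ₑ = L a + 1 := by
    rw [← ofReal_norm, Complex.norm_real, Real.norm_of_nonneg hK.le, hKe]
  have hK0 : (K : ℂ) ≠ 0 := by exact_mod_cast hK.ne'
  have hKi : ‖((K : ℂ)⁻¹)‖ₑ * (L a + 1) = 1 := by
    rw [← hKn, ← enorm_mul, inv_mul_cancel₀ hK0]
    simp
  have h1 : L ((K : ℂ)⁻¹ • a) ≤ 1 := by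
    rw [hsmul, ← hKi]
    gcongr
    exact le_self_add
  have h2 : ‖μ.1 (toClosure ((K : ℂ)⁻¹ • a)) - ν.1 (toClosure ((K : ℂ)⁻¹ • a))‖ₑ ≤
      stateDist A L μ ν := le_iSup₂_of_le _ h1 le_rfl
  have h3 : ∀ κ : States A, κ.1 (toClosure a) = K * κ.1 (toClosure ((K : ℂ)⁻¹ • a)) := by
    intro κ
    rw [show toClosure ((K : ℂ)⁻¹ • a) = (K : ℂ)⁻¹ • toClosure a from rfl, map_smul, smul_eq_mul,
      mul_inv_cancel_left₀ hK0]
  rw [h3 μ, h3 ν, ← mul_sub, enorm_mul, hKn]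
  gcongr

theorem exists_near_toClosure (b : A.topologicalClosure) {ε : ℝ} (hε : 0 < ε) :
    ∃ a : A, ‖b - toClosure a‖ < ε := by
  have hb : (b : H →L[ℂ] H) ∈ closure (A : Set (H →L[ℂ] H)) := b.2
  obtain ⟨a, ha, hab⟩ := Metric.mem_closure_iff.mp hb ε hε
  refine ⟨⟨a, ha⟩, ?_⟩
  rw [dist_eq_norm] at hab
  exact hab

theorem eq_of_stateDist_eq_zero (hfinite : ∀ a, L a < ∞)
    (hsmul : ∀ (c : ℂ) (a), L (c • a) = ‖c‖ₑ * L a) {μ ν : States A}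
    (h : stateDist A L μ ν = 0) : μ = ν := by
  refine Subtype.ext (DFunLike.ext _ _ fun b => ?_)
  rw [← sub_eq_zero, ← norm_le_zero_iff]
  refine le_of_forall_pos_le_add fun ε hε => ?_
  obtain ⟨a, ha⟩ := exists_near_toClosure b (show 0 < ε / 8 by positivity)
  have h1 := enorm_sub_le_mul_stateDist hfinite hsmul μ ν a
  rw [h, mul_zero, nonpos_iff_eq_zero, enorm_eq_zero] at h1
  have h2 := μ.norm_sub_apply_le ν (b - toClosure a)
  rw [map_sub, map_sub, sub_sub_sub_comm, h1, sub_zero] at h2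
  linarith

/-- If the unit ball of `L` has finite `ε`-nets modulo scalars, then `ρ_L` is finite. -/
theorem stateDist_lt_top
    (hnet : ∀ ε : ℝ, 0 < ε → ∃ t : Set A, t.Finite ∧ ∀ a, L a ≤ 1 →
      ∃ b ∈ t, ∃ z : ℂ, ‖(a : H →L[ℂ] H) - b - algebraMap ℂ _ z‖ ≤ ε) (μ ν : States A) :
    stateDist A L μ ν < ∞ := by
  obtain ⟨t, ht, hnet⟩ := hnet 1 one_pos
  obtain ⟨M, hM⟩ := (ht.image fun b => ‖μ.1 (toClosure b) - ν.1 (toClosure b)‖).bddAbove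
  refine lt_of_le_of_lt (iSup₂_le fun a ha => ?_) (ENNReal.ofReal_lt_top (r := M + 8 * 1))
  obtain ⟨b, hb, z, hz⟩ := hnet a ha
  rw [← ofReal_norm]
  exact ENNReal.ofReal_le_ofReal ((μ.norm_sub_le_of_near ν a b z hz).trans
    (by gcongr; exact hM ⟨b, hb, rfl⟩))

/-- Rieffel's criterion: if the unit ball of `L` has finite `ε`-nets modulo scalars, then `ρ_L`
induces the weak-* topology. -/
theorem stateMetricTopology_eq (hfinite : ∀ a, L a < ∞)
    (hsmul : ∀ (c : ℂ) (a), L (c • a) = ‖c‖ₑ * L a)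
    (hnet : ∀ ε : ℝ, 0 < ε → ∃ t : Set A, t.Finite ∧ ∀ a, L a ≤ 1 →
      ∃ b ∈ t, ∃ z : ℂ, ‖(a : H →L[ℂ] H) - b - algebraMap ℂ _ z‖ ≤ ε) :
    stateMetricTopology A L = stateWeakStarTopology A := by
  refine TopologicalSpace.ext_nhds fun μ => ?_
  have hbasis : (@nhds _ (stateMetricTopology A L) μ).HasBasis (fun ε : ℝ≥0∞ => 0 < ε)
      fun ε => {ν | stateDist A L ν μ < ε} :=
    @Metric.nhds_basis_eball _ (statePseudoEMetric A L) μ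
  refine le_antisymm ?_ ?_
  · rw [nhds_subtype_eq_comap, ← tendsto_iff_comap]
    refine tendsto_iff_forall_eval_tendsto_topDualPairing.mpr fun b => ?_
    change Tendsto (fun ν : States A => ν.1 b) _ (𝓝 (μ.1 b))
    rw [Metric.tendsto_nhds]
    intro ε hε
    obtain ⟨a, ha⟩ := exists_near_toClosure b (show 0 < ε / 16 by positivity)
    have hfin : L a + 1 ≠ ∞ := (ENNReal.add_lt_top.mpr ⟨hfinite a, ENNReal.one_lt_top⟩).ne
    refine hbasis.mem_iff.mpr ⟨ENNReal.ofReal (ε / 2) / (L a + 1),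
      ENNReal.div_pos (by simpa using hε) hfin, fun ν hν => ?_⟩
    have h1 := enorm_sub_le_mul_stateDist hfinite hsmul ν μ a
    have h2 : (L a + 1) * stateDist A L ν μ < ENNReal.ofReal (ε / 2) := by
      rw [mul_comm]
      exact (ENNReal.lt_div_iff_mul_lt (Or.inl (by simp)) (Or.inl hfin)).mp hν
    have h3 := h1.trans_lt h2
    rw [← ofReal_norm, ENNReal.ofReal_lt_ofReal_iff (by positivity)] at h3
    have h4 := ν.norm_sub_apply_le μ (b - toClosure a)
    change dist (ν.1 b) (μ.1 b) < ε
    rw [dist_eq_norm]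
    have h5 : ν.1 b - μ.1 b = (ν.1 (b - toClosure a) - μ.1 (b - toClosure a)) +
        (ν.1 (toClosure a) - μ.1 (toClosure a)) := by
      rw [map_sub, map_sub]; ring
    rw [h5]
    refine (norm_add_le _ _).trans_lt ?_
    linarith
  · refine hbasis.ge_iff.mpr fun ε hε => ?_
    obtain ⟨δ, hδ0, hδ⟩ : ∃ δ : ℝ, 0 < δ ∧ ENNReal.ofReal (9 * δ) < ε := by
      obtain ⟨r, hr0, hr⟩ := ENNReal.lt_iff_exists_nnreal_btwn.mp hε
      refine ⟨r / 9, by have : (0 : ℝ) < r := by exact_mod_cast hr0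
                        positivity, ?_⟩
      rw [mul_div_cancel₀ _ (by norm_num : (9 : ℝ) ≠ 0), ENNReal.ofReal_coe_nnreal]
      exact hr
    obtain ⟨t, ht, hnet⟩ := hnet δ hδ0
    have hev : ∀ b ∈ t, ∀ᶠ ν : States A in 𝓝 μ,
        ‖ν.1 (toClosure b) - μ.1 (toClosure b)‖ < δ := by
      intro b _
      have hcont : Continuous fun ν : States A => ν.1 (toClosure b) :=
        (WeakDual.eval_continuous _).comp continuous_subtype_val
      have := Metric.tendsto_nhds.mp (hcont.tendsto μ) δ hδ0
      simpa only [dist_eq_norm] using this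
    filter_upwards [(eventually_all_finite ht).mpr hev] with ν hν
    refine lt_of_le_of_lt (iSup₂_le fun a ha => ?_) hδ
    obtain ⟨b, hb, z, hz⟩ := hnet a ha
    rw [← ofReal_norm]
    refine ENNReal.ofReal_le_ofReal ((ν.norm_sub_le_of_near μ a b z hz).trans ?_)
    linarith [hν b hb]

end StateSpaces

/-! ### The seminorm of a word length -/

section WordSeminorm

variable {G : Type*} [Group G] {S : Set G}

theorem exists_convolutionRep_eq (a : convolutionOperators G) :
    ∃ g, convolutionRep G g = a.1 := a.2

theorem wordSeminorm_eq_zero_iff (hS : Subgroup.closure S = ⊤) (a : convolutionOperators G) :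
    wordSeminorm S a = 0 ↔ ∃ c : ℂ, a = algebraMap ℂ _ c := by
  classical
  obtain ⟨g, hg⟩ := exists_convolutionRep_eq a
  rw [wordSeminorm_eq hS g a hg.symm]
  refine ⟨fun h => ⟨g.coeff 1, Subtype.ext ?_⟩, ?_⟩
  · rw [← ofReal_norm, ENNReal.ofReal_eq_zero, norm_le_zero_iff] at h
    have hsingle : g = MonoidAlgebra.single 1 (g.coeff 1) := by
      ext x
      by_cases hx : x = 1
      · simp [hx, MonoidAlgebra.coeff_single]
      · have h1 := commutatorOp_single_one hS g x
        rw [h] at h1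
        have h2 : (wordLength S x : ℂ) ≠ 0 := by
          exact_mod_cast fun h0 => hx ((wordLength_eq_zero_iff hS).mp h0)
        have h3 : g.coeff x = 0 := (mul_eq_zero.mp h1.symm).resolve_left h2
        simp [h3, MonoidAlgebra.coeff_single, Ne.symm hx]
    rw [← hg]
    conv_lhs => rw [hsingle]
    rw [convolutionRep_single_one]
    rfl
  · rintro ⟨c, rfl⟩
    rw [← wordSeminorm_eq hS g _ hg.symm, wordSeminorm_eq hS (MonoidAlgebra.single 1 c) _
      (convolutionRep_single_one c).symm, commutatorOp_scalar, ← ofReal_norm, norm_zero,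
      ENNReal.ofReal_zero]

theorem wordSeminorm_lt_top (hS : Subgroup.closure S = ⊤) (a : convolutionOperators G) :
    wordSeminorm S a < ∞ := by
  obtain ⟨g, hg⟩ := exists_convolutionRep_eq a
  rw [wordSeminorm_eq hS g a hg.symm]
  exact enorm_lt_top

theorem wordSeminorm_add_le (hS : Subgroup.closure S = ⊤) (a b : convolutionOperators G) :
    wordSeminorm S (a + b) ≤ wordSeminorm S a + wordSeminorm S b := by
  obtain ⟨g, hg⟩ := exists_convolutionRep_eq a
  obtain ⟨h, hh⟩ := exists_convolutionRep_eq b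
  rw [wordSeminorm_eq hS g a hg.symm, wordSeminorm_eq hS h b hh.symm,
    wordSeminorm_eq hS (g + h) (a + b) (by rw [map_add, hg, hh]; rfl), commutatorOp_add]
  exact enorm_add_le (E := EllTwo G →L[ℂ] EllTwo G) _ _

theorem wordSeminorm_smul (hS : Subgroup.closure S = ⊤) (c : ℂ) (a : convolutionOperators G) :
    wordSeminorm S (c • a) = ‖c‖ₑ * wordSeminorm S a := by
  obtain ⟨g, hg⟩ := exists_convolutionRep_eq a
  rw [wordSeminorm_eq hS g a hg.symm,
    wordSeminorm_eq hS (c • g) (c • a) (by rw [map_smul, hg]; rfl), commutatorOp_smul, enorm_smul]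

theorem exists_finite_net_wordSeminorm (hG : IsWordHyperbolic G) (hfin : S.Finite)
    (hS : Subgroup.closure S = ⊤) (ε : ℝ) (hε : 0 < ε) :
    ∃ t : Set (convolutionOperators G), t.Finite ∧ ∀ a, wordSeminorm S a ≤ 1 → ∃ b ∈ t, ∃ z : ℂ,
      ‖(a : EllTwo G →L[ℂ] EllTwo G) - b - algebraMap ℂ _ z‖ ≤ ε := by
  obtain ⟨t, ht, hnet⟩ := exists_finite_net_commutatorOp hG hfin hS hε
  refine ⟨(fun g => ⟨convolutionRep G g, g, rfl⟩) '' t, ht.image _, fun a ha => ?_⟩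
  obtain ⟨g, hg⟩ := exists_convolutionRep_eq a
  rw [wordSeminorm_eq hS g a hg.symm] at ha
  obtain ⟨h, hht, z, hz⟩ := hnet g ha
  exact ⟨_, ⟨h, hht, rfl⟩, z, by rw [← hg]; exact hz⟩

end WordSeminorm

end

theorem corollary4p4 {G : Type*} [Group G] (hG : IsWordHyperbolic G)
    (S : Set G) (hS : S.Finite) (hgen : Subgroup.closure S = ⊤) :
    -- every commutator `[M_ℓ, a]` is densely defined
    (∀ a : convolutionOperators G,
      Dense ((diracCommutator (wordDirac S) a.1).domain : Set (EllTwo G))) ∧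
    -- `ρ_L` is a metric on the state space of the reduced group algebra
    (∀ μ ν : stateSpace (ReducedGroupCStarAlgebra G),
      stateDist (convolutionOperators G) (wordSeminorm S) μ ν < ⊤) ∧
    (∀ μ ν : stateSpace (ReducedGroupCStarAlgebra G),
      stateDist (convolutionOperators G) (wordSeminorm S) μ ν = 0 → μ = ν) ∧
    -- its topology is the weak-* topology
    stateMetricTopology (convolutionOperators G) (wordSeminorm S) =
      stateWeakStarTopology (convolutionOperators G) ∧
    -- the algebra with this seminorm is a compact quantum metric space
    IsCompactQuantumMetricSpace (convolutionOperators G) (wordSeminorm S) := by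
  have htop := stateMetricTopology_eq (wordSeminorm_lt_top hgen) (wordSeminorm_smul hgen)
    (exists_finite_net_wordSeminorm hG hS hgen)
  refine ⟨fun a => ?_, stateDist_lt_top (exists_finite_net_wordSeminorm hG hS hgen),
    fun μ ν => eq_of_stateDist_eq_zero (wordSeminorm_lt_top hgen) (wordSeminorm_smul hgen),
    htop, wordSeminorm_lt_top hgen, wordSeminorm_add_le hgen, wordSeminorm_smul hgen,
    wordSeminorm_eq_zero_iff hgen, htop⟩
  obtain ⟨g, hg⟩ := exists_convolutionRep_eq a
  rw [← hg, diracCommutator_domain hgen]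
  exact dense_mulOperator_domain _
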